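/- A polyhedron in $\mathbb{R}^d$ is an intersection of finitely many closed halfspaces. For a polyhedron $Q \subseteq \mathbb{R}^d$ let $\mathcal{F}(Q)$ be the (finite) set of nonempty faces of $Q$, including $Q$ itself if $Q \neq \emptyset$, where a nonempty face is the nonempty set of all maximizers over $Q$ of some linear functional. For $F \in \mathcal{F}(Q)$ let $\dim F$ be the dimension of its affine hull, and let $$N_F Q = \{ c \in \mathbb{R}^d : \langle c, x\rangle \le \langle c, y\rangle \text{ for all } x \in Q,\ y \in F \}$$ be the normal cone of $Q$ at $F$. Let $\epsilon(Q) = \sum_{F \in \mathcal{F}(Q)} (-1)^{\dim F}$ be the Euler characteristic of $Q$, and write $[S] : \mathbb{R}^d \to \mathbb{Z}$ for the indicator function of $S \subseteq \mathbb{R}^d$. Then, for every polyhedron $Q \subseteq \mathbb{R}^d$, the equality of functions $$\epsilon(Q) \cdot [\mathbb{R}^d] \;=\; \sum_{F \in \mathcal{F}(Q)} (-1)^{\dim F}\, [F - N_F Q]$$ holds at every point of $\mathbb{R}^d$, where $F - N_F Q = \{ y - c : y \in F,\ c \in N_F Q \}$. -/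

import Mathlib

open scoped Pointwise

namespace Polyhedra

/-- `Q ⊆ ℝᵈ` is a polyhedron: the intersection of finitely many closed halfspaces. -/
def IsPolyhedron {d : ℕ} (Q : Set (EuclideanSpace ℝ (Fin d))) : Prop :=
  ∃ (n : ℕ) (a : Fin n → EuclideanSpace ℝ (Fin d)) (b : Fin n → ℝ),
    Q = {x | ∀ i, inner ℝ (a i) x ≤ b i}

/-- The set of nonempty faces of `Q`. A nonempty exposed subset of `Q` is the set of all points
of `Q` at which some linear functional attains its maximum over `Q`; the zero functional gives
the face `Q` itself. -/
def faces {d : ℕ} (Q : Set (EuclideanSpace ℝ (Fin d))) :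
    Set (Set (EuclideanSpace ℝ (Fin d))) :=
  {F | F.Nonempty ∧ IsExposed ℝ Q F}

/-- The dimension of the affine hull of `F` (used for nonempty `F`). -/
noncomputable def dim {d : ℕ} (F : Set (EuclideanSpace ℝ (Fin d))) : ℕ :=
  Module.finrank ℝ (vectorSpan ℝ F)

/-- The normal cone of `Q` at `F`. -/
def normalCone {d : ℕ} (F Q : Set (EuclideanSpace ℝ (Fin d))) :
    Set (EuclideanSpace ℝ (Fin d)) :=
  {c | ∀ x ∈ Q, ∀ y ∈ F, inner ℝ c x ≤ inner ℝ c y}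

/-- The integer-valued indicator function of `S`. -/
noncomputable def ind {d : ℕ} (S : Set (EuclideanSpace ℝ (Fin d))) :
    EuclideanSpace ℝ (Fin d) → ℤ :=
  S.indicator 1

/-- The Euler characteristic: the alternating sum over the nonempty faces by dimension.
(A polyhedron has finitely many faces, see `IsPolyhedron.finite_faces`.) -/
noncomputable def eulerChar {d : ℕ} (Q : Set (EuclideanSpace ℝ (Fin d))) : ℤ :=
  ∑ᶠ F ∈ faces Q, (-1 : ℤ) ^ dim F

/-- A polyhedron has only finitely many nonempty faces, so that sums over them are genuine. -/
theorem IsPolyhedron.finite_faces {d : ℕ} {Q : Set (EuclideanSpace ℝ (Fin d))}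
    (hQ : IsPolyhedron Q) : (faces Q).Finite := by
  obtain ⟨n, a, b, rfl⟩ := hQ
  set Q : Set (EuclideanSpace ℝ (Fin d)) := {x | ∀ i, inner ℝ (a i) x ≤ b i} with hQ
  -- a face is contained in every face at which at least its own constraints are tight
  have key : ∀ F ∈ faces Q, ∀ y ∈ Q,
      (∀ i, (∀ x ∈ F, inner ℝ (a i) x = b i) → inner ℝ (a i) y = b i) → y ∈ F := by
    rintro F ⟨hne, hF⟩ y hy htight
    obtain ⟨l, hl⟩ := hF hne
    have hFQ : F ⊆ Q := by
      rw [hl]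
      exact fun x hx => hx.1
    let A : EuclideanSpace ℝ (Fin d) → Set (Fin n) := fun x => {i | inner ℝ (a i) x = b i}
    obtain ⟨x₀, hx₀, hmin⟩ : ∃ x₀ ∈ F, ∀ x ∈ F, (A x₀).ncard ≤ (A x).ncard := by
      obtain ⟨x₀, hx₀⟩ := exists_minimal_of_wellFoundedLT
        (fun m => ∃ x ∈ F, (A x).ncard = m) ⟨_, hne.some, hne.some_mem, rfl⟩
      obtain ⟨x, hx, rfl⟩ := hx₀.1
      refine ⟨x, hx, fun z hz => ?_⟩
      by_contra hlt
      exact hlt (hx₀.2 ⟨z, hz, rfl⟩ (le_of_not_ge hlt))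
    have hAx₀ : ∀ i, inner ℝ (a i) x₀ = b i → ∀ x ∈ F, inner ℝ (a i) x = b i := by
      intro i hi x hx
      let m : EuclideanSpace ℝ (Fin d) := (1 / 2 : ℝ) • x₀ + (1 / 2 : ℝ) • x
      have him : ∀ j, inner ℝ (a j) m
          = (1 / 2 : ℝ) * inner ℝ (a j) x₀ + (1 / 2 : ℝ) * inner ℝ (a j) x := by
        intro j
        simp only [m, inner_add_right, inner_smul_right]
      have hmF : m ∈ F := by
        rw [hl] at hx hx₀ ⊢
        refine ⟨fun j => ?_, fun z hz => ?_⟩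
        · rw [him]
          linarith [hx.1 j, hx₀.1 j]
        · simp only [m, map_add, map_smul, smul_eq_mul]
          linarith [hx.2 z hz, hx₀.2 z hz]
      have hsub : A m ⊆ A x₀ := by
        intro j hj
        have hj' : inner ℝ (a j) m = b j := hj
        rw [him] at hj'
        change inner ℝ (a j) x₀ = b j
        linarith [hFQ hx j, hFQ hx₀ j]
      have heq : A m = A x₀ := Set.eq_of_subset_of_ncard_le hsub (hmin m hmF) (Set.toFinite _)
      have him' : i ∈ A m := heq ▸ hi
      have : inner ℝ (a i) m = b i := him'
      rw [him] at this
      linarith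
    obtain ⟨t, ht, htQ⟩ : ∃ t : ℝ, 0 < t ∧ x₀ + t • (x₀ - y) ∈ Q := by
      have hev : ∀ᶠ t : ℝ in nhdsWithin 0 (Set.Ioi 0),
          ∀ i, inner ℝ (a i) (x₀ + t • (x₀ - y)) ≤ b i := by
        rw [Filter.eventually_all]
        intro i
        by_cases hi : inner ℝ (a i) x₀ = b i
        · have hiy := htight i (hAx₀ i hi)
          refine Filter.Eventually.of_forall fun t => ?_
          rw [inner_add_right, inner_smul_right, inner_sub_right, hi, hiy]
          simp
        · have hlt : inner ℝ (a i) x₀ < b i := lt_of_le_of_ne (hFQ hx₀ i) hi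
          have hc : ContinuousAt
              (fun t : ℝ => (inner ℝ (a i) (x₀ + t • (x₀ - y)) : ℝ)) 0 := by
            fun_prop
          have : ∀ᶠ t : ℝ in nhds 0, inner ℝ (a i) (x₀ + t • (x₀ - y)) < b i :=
            hc.eventually_lt continuousAt_const (by simpa using hlt)
          exact (this.filter_mono nhdsWithin_le_nhds).mono fun t h => h.le
      obtain ⟨t, h1, h2⟩ := (hev.and self_mem_nhdsWithin).exists
      exact ⟨t, h2, h1⟩
    rw [hl] at hx₀ ⊢
    have h1 := hx₀.2 _ htQ
    simp only [map_add, map_smul, map_sub, smul_eq_mul] at h1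
    refine ⟨hy, fun z hz => (hx₀.2 z hz).trans ?_⟩
    by_contra hlt
    push Not at hlt
    have := mul_pos ht (sub_pos.2 hlt)
    linarith
  refine Set.Finite.of_finite_image (f := fun F : Set (EuclideanSpace ℝ (Fin d)) =>
    {i : Fin n | ∀ x ∈ F, inner ℝ (a i) x = b i}) (Set.toFinite _) ?_
  intro F hF G hG hFG
  have hFG' : ∀ i, (∀ x ∈ F, inner ℝ (a i) x = b i) ↔ (∀ x ∈ G, inner ℝ (a i) x = b i) :=
    fun i => Set.ext_iff.1 hFG i
  apply Set.Subset.antisymm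
  · exact fun y hy => key G hG y (hF.2.subset hy) fun i hi => (hFG' i).2 hi y hy
  · exact fun y hy => key F hF y (hG.2.subset hy) fun i hi => (hFG' i).1 hi y hy

end Polyhedra

open scoped Pointwise

namespace Polyhedra

/-! Fix `z`. Each nonempty face is the closure of a cell, the relatively open set where a prescribed
set of inequalities is exactly the tight one. That `z ∈ F - N_F Q` means that some `y ∈ F` has `y -
z` normal along `F`, and such a `y` is unique (`IsNormal.unique`). The claim becomes: the signs of
the critical cells and the signs of all cells have the same sum, i.e. the total defect vanishes.

The total defect is a valuation: for a polyhedron P cut by a hyperplane H, the totals of the two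
halves add up to those of P and P ∩ H (`defect_cut`, `totalDefect_add_flip`). In an induction on the
set of inequalities, over all ambient affine subspaces `A`, the totals of P and P ∩ H are zero.
Hence reversing an inequality only changes the sign of the total, and the orientations can be chosen
freely (`totalDefect_eq_zero_of_flip`).

If the normals are dependent on the direction of `A`, some orientation forces the polyhedron into
one of its bounding hyperplanes, and one inequality is absorbed into `A`. If they are independent,
the polyhedron is a simplicial cone. Let p be the projection of `z` to `A`. If p lies on all the
hyperplanes, it witnesses that every cell is critical. Otherwise orient the cone away from p: no
nonempty cell is critical (`not_critical_cell`), and the signs cancel in pairs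
(`sum_sign_cell_eq_zero`). -/

variable {V : Type*} [NormedAddCommGroup V] [InnerProductSpace ℝ V]

/-! ### Relatively open convex sets and their radial closures -/

/-- A convex set in which every segment can be prolonged beyond its endpoints. -/
def RelOpen (U : Set V) : Prop :=
  Convex ℝ U ∧ ∀ x ∈ U, ∀ y ∈ U, ∃ t : ℝ, 0 < t ∧ x + t • (x - y) ∈ U

/-- The points from which every half-open segment to a point of `U` stays in `U`. -/
def radialClosure (U : Set V) : Set V :=
  {y | ∀ p ∈ U, ∀ t : ℝ, 0 < t → t ≤ 1 → y + t • (p - y) ∈ U}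

theorem convex_step {U : Set V} (hU : Convex ℝ U) {x y : V} (hx : x ∈ U) (hy : y ∈ U)
    {t : ℝ} (h0 : 0 ≤ t) (h1 : t ≤ 1) : x + t • (y - x) ∈ U :=
  hU.add_smul_sub_mem hx hy ⟨h0, h1⟩

theorem inner_add_smul_sub (a x y : V) (t : ℝ) :
    inner ℝ a (x + t • (y - x)) = inner ℝ a x + t * (inner ℝ a y - inner ℝ a x) := by
  simp only [inner_add_right, inner_smul_right, inner_sub_right]

/-- If `f < b` at `x`, then it stays so after moving a little towards any value. -/
theorem exists_small_step {α β b : ℝ} (h : α < b) :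
    ∃ t : ℝ, 0 < t ∧ t ≤ 1 ∧ ∀ s, 0 ≤ s → s ≤ t → α + s * β < b := by
  -- The `+ 1` keeps the denominator positive when `β = 0`.
  refine ⟨min 1 ((b - α) / (2 * (|β| + 1))), ?_, min_le_left _ _, fun s hs hst => ?_⟩
  · have : 0 < b - α := sub_pos.2 h
    positivity
  · have h1 : s ≤ (b - α) / (2 * (|β| + 1)) := hst.trans (min_le_right _ _)
    rw [le_div_iff₀ (by positivity)] at h1
    have h2 : s * β ≤ s * |β| := mul_le_mul_of_nonneg_left (le_abs_self β) hs
    nlinarith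

theorem RelOpen.inter {U W : Set V} (hU : RelOpen U) (hW : RelOpen W) : RelOpen (U ∩ W) := by
  refine ⟨hU.1.inter hW.1, fun x hx y hy => ?_⟩
  obtain ⟨t, ht, htU⟩ := hU.2 x hx.1 y hy.1
  obtain ⟨s, hs, hsW⟩ := hW.2 x hx.2 y hy.2
  have aux : ∀ {X : Set V}, Convex ℝ X → x ∈ X → ∀ {r : ℝ}, 0 < r → x + r • (x - y) ∈ X →
      min t s ≤ r → x + min t s • (x - y) ∈ X := by
    intro X hX hx r hr hrX hle
    have := convex_step hX hx hrX (t := min t s / r) (by positivity)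
      ((div_le_one hr).2 hle)
    rwa [add_sub_cancel_left, smul_smul, div_mul_cancel₀ _ hr.ne'] at this
  exact ⟨min t s, lt_min ht hs, aux hU.1 hx.1 ht htU (min_le_left _ _),
    aux hW.1 hx.2 hs hsW (min_le_right _ _)⟩

theorem relOpen_lt (a : V) (b : ℝ) : RelOpen {x : V | inner ℝ a x < b} := by
  refine ⟨fun x hx y hy s t hs ht hst => ?_, fun x hx y _ => ?_⟩
  · simp only [Set.mem_ofPred_eq, inner_add_right, inner_smul_right] at *
    have hs' : s = 1 - t := by linarith
    subst hs'
    rcases ht.eq_or_lt with rfl | ht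
    · simpa using hx
    · nlinarith
  · obtain ⟨t, ht, -, h⟩ := exists_small_step (β := inner ℝ a x - inner ℝ a y)
      (show inner ℝ a x < b from hx)
    refine ⟨t, ht, ?_⟩
    have := h t ht.le le_rfl
    simpa only [Set.mem_ofPred_eq, inner_add_right, inner_smul_right, inner_sub_right] using this

/-- The affine hyperplane with normal vector `a` at level `b`. -/
def hyperplane (a : V) (b : ℝ) : AffineSubspace ℝ V where
  carrier := {x | inner ℝ a x = b}
  smul_vsub_vadd_mem' := by
    intro c x y z hx hy hz
    simp only [Set.mem_ofPred_eq, vsub_eq_sub, vadd_eq_add, inner_add_right, inner_smul_right,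
      inner_sub_right] at *
    rw [hx, hy, hz]; ring

theorem relOpen_affineSubspace (A : AffineSubspace ℝ V) : RelOpen (A : Set V) := by
  refine ⟨A.convex, fun x hx y hy => ⟨1, one_pos, ?_⟩⟩
  have := A.smul_vsub_vadd_mem 1 hx hy hx
  simpa [add_comm] using this

theorem relOpen_eq (a : V) (b : ℝ) : RelOpen {x : V | inner ℝ a x = b} :=
  relOpen_affineSubspace (hyperplane a b)

theorem convex_le (a : V) (b : ℝ) : Convex ℝ {x : V | inner ℝ a x ≤ b} := by
  intro x hx y hy s t hs ht hst
  simp only [Set.mem_ofPred_eq, inner_add_right, inner_smul_right] at *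
  have hs' : s = 1 - t := by linarith
  subst hs'
  nlinarith

/-- From a point of a relatively open set one can move in every direction of its span. -/
theorem RelOpen.exists_add_smul_mem {U : Set V} (hU : RelOpen U) {p : V} (hp : p ∈ U) {w : V}
    (hw : w ∈ vectorSpan ℝ U) : ∃ t : ℝ, 0 < t ∧ p + t • w ∈ U := by
  rw [vectorSpan_eq_span_vsub_set_right ℝ hp] at hw
  induction hw using Submodule.span_induction with
  | mem x hx =>
    obtain ⟨y, hy, rfl⟩ := hx
    exact ⟨1, one_pos, by simpa using hy⟩
  | zero => exact ⟨1, one_pos, by simpa using hp⟩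
  | add x y _ _ hx hy =>
    obtain ⟨t, ht, htx⟩ := hx
    obtain ⟨s, hs, hsy⟩ := hy
    -- The convex combination of `p + t • x` and `p + s • y` with weights `s / (s + t)` and `t / (s
    -- + t)` gives both directions the coefficient `s * t / (s + t)`.
    refine ⟨s * t / (s + t), by positivity, ?_⟩
    have := hU.1 htx hsy (show 0 ≤ s / (s + t) by positivity)
      (show 0 ≤ t / (s + t) by positivity) (by field_simp)
    convert this using 1
    have hst : s + t ≠ 0 := by positivity
    match_scalars <;> field_simp
  | smul c x _ hx =>
    obtain ⟨t, ht, htx⟩ := hx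
    rcases lt_trichotomy c 0 with hc | rfl | hc
    · obtain ⟨r, hr, hrx⟩ := hU.2 p hp _ htx
      refine ⟨r * t / (-c), div_pos (mul_pos hr ht) (neg_pos.2 hc), ?_⟩
      convert hrx using 1
      match_scalars
      · ring
      · have := hc.ne
        field_simp
    · exact ⟨1, one_pos, by simpa using hp⟩
    · refine ⟨t / c, by positivity, ?_⟩
      convert htx using 2
      rw [smul_smul, div_mul_cancel₀ _ hc.ne']

/-- Radial closure can be tested on the segments to a single point. -/
theorem RelOpen.mem_radialClosure {U : Set V} (hU : RelOpen U) {p y : V} (hp : p ∈ U)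
    (h : ∀ t : ℝ, 0 < t → t ≤ 1 → y + t • (p - y) ∈ U) : y ∈ radialClosure U := by
  intro q hq t ht ht1
  obtain ⟨s, hs, hsU⟩ := hU.2 q hq p hp
  -- `q` lies between `p` and `q + s • (q - p)`
  have hd : 0 < 1 + s * (1 - t) := by nlinarith
  -- Substituting this for `q` turns `y + t • (q - y)` into weight `t / (1 + s)` on `q + s • (q -
  -- p)` and the remaining weight on a point of the segment from `y` to `p`; the parameter below is
  -- that point.
  have h1 := h (t * s / (1 + s) / (1 - t + t * s / (1 + s)))
    (by
      have : 0 < t * s / (1 + s) := by positivity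
      have : 0 ≤ 1 - t := by linarith
      positivity)
    (by
      have : 0 < t * s / (1 + s) := by positivity
      rw [div_le_one (by linarith)]
      linarith)
  have h2 : 0 < t * s / (1 + s) := by positivity
  have h4 : t / (1 + s) + (1 - t + t * s / (1 + s)) = 1 := by field_simp; ring
  have := hU.1 hsU h1 (show 0 ≤ t / (1 + s) by positivity)
    (show 0 ≤ 1 - t + t * s / (1 + s) by linarith) h4
  convert this using 1
  have h3 : 1 - t + t * s / (1 + s) ≠ 0 := by linarith
  have h5 : (1 + s) ≠ 0 := by positivity
  set m := 1 - t + t * s / (1 + s) with hm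
  match_scalars
  · field_simp
    rw [hm]; field_simp; ring
  · field_simp
    try ring
  · field_simp
    try ring

theorem subset_radialClosure {U : Set V} (hU : Convex ℝ U) : U ⊆ radialClosure U :=
  fun _ hy _ hp _ h0 h1 => convex_step hU hy hp h0.le h1

theorem inner_le_of_mem_radialClosure {U : Set V} {a : V} {b : ℝ} (hne : U.Nonempty)
    (hU : ∀ x ∈ U, inner ℝ a x ≤ b) {y : V} (hy : y ∈ radialClosure U) : inner ℝ a y ≤ b := by
  obtain ⟨p, hp⟩ := hne
  by_contra hlt
  push Not at hlt
  obtain ⟨t, ht, ht1, h⟩ := exists_small_step (β := -(inner ℝ a p - inner ℝ a y))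
    (neg_lt_neg hlt)
  have h1 := hU _ (hy p hp t ht ht1)
  have h2 := h t ht.le le_rfl
  rw [inner_add_smul_sub] at h1
  linarith

theorem inner_eq_of_mem_radialClosure {U : Set V} {a : V} {b : ℝ} (hne : U.Nonempty)
    (hU : ∀ x ∈ U, inner ℝ a x = b) {y : V} (hy : y ∈ radialClosure U) : inner ℝ a y = b := by
  refine le_antisymm (inner_le_of_mem_radialClosure hne (fun x hx => (hU x hx).le) hy) ?_
  have := inner_le_of_mem_radialClosure (a := -a) (b := -b) hne
    (fun x hx => by rw [inner_neg_left, hU x hx]) hy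
  rw [inner_neg_left] at this
  linarith

theorem radialClosure_inter_subset {U W : Set V} (hU : RelOpen U)
    (hne : (U ∩ W).Nonempty) : radialClosure (U ∩ W) ⊆ radialClosure U := by
  obtain ⟨p, hp⟩ := hne
  exact fun y hy => hU.mem_radialClosure hp.1 fun t h0 h1 => (hy p hp t h0 h1).1

/-- Strictness at the inner endpoint makes the whole half-open segment strict, even when `y` lies on
the hyperplane. Nonemptiness matters because the radial closure of `∅` is everything. -/
theorem mem_radialClosure_inter_lt {U : Set V} (hU : RelOpen U) {a : V} {b : ℝ}
    (hne : (U ∩ {x | inner ℝ a x < b}).Nonempty) {y : V} :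
    y ∈ radialClosure (U ∩ {x | inner ℝ a x < b}) ↔ y ∈ radialClosure U ∧ inner ℝ a y ≤ b := by
  refine ⟨fun h => ⟨radialClosure_inter_subset hU hne h,
    inner_le_of_mem_radialClosure hne (fun x hx => le_of_lt hx.2) h⟩,
    fun h p hp t h0 h1 => ⟨h.1 p hp.1 t h0 h1, ?_⟩⟩
  have h2 : inner ℝ a p < b := hp.2
  rw [Set.mem_ofPred_eq, inner_add_smul_sub]
  nlinarith [h.2]

theorem mem_radialClosure_inter_eq {U : Set V} (hU : RelOpen U) {a : V} {b : ℝ}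
    (hne : (U ∩ {x | inner ℝ a x = b}).Nonempty) {y : V} :
    y ∈ radialClosure (U ∩ {x | inner ℝ a x = b}) ↔ y ∈ radialClosure U ∧ inner ℝ a y = b := by
  refine ⟨fun h => ⟨radialClosure_inter_subset hU hne h,
    inner_eq_of_mem_radialClosure hne (fun x hx => hx.2) h⟩,
    fun h p hp t h0 h1 => ⟨h.1 p hp.1 t h0 h1, ?_⟩⟩
  have h2 : inner ℝ a p = b := hp.2
  rw [Set.mem_ofPred_eq, inner_add_smul_sub, h2, h.2]
  ring

theorem mem_radialClosure_inter_gt {U : Set V} (hU : RelOpen U) {a : V} {b : ℝ}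
    (hne : (U ∩ {x | b < inner ℝ a x}).Nonempty) {y : V} :
    y ∈ radialClosure (U ∩ {x | b < inner ℝ a x}) ↔ y ∈ radialClosure U ∧ b ≤ inner ℝ a y := by
  have := mem_radialClosure_inter_lt hU (a := -a) (b := -b) (y := y)
  simp only [inner_neg_left, neg_lt_neg_iff, neg_le_neg_iff] at this
  exact this hne

/-! ### Cutting a relatively open set by a hyperplane -/

/-- From a base point strictly below `b`, a small positive multiple of every difference vector stays
below `b`, so no direction is lost. -/
theorem RelOpen.vectorSpan_inter_lt {U : Set V} (hU : RelOpen U) {a : V} {b : ℝ}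
    (hne : (U ∩ {x | inner ℝ a x < b}).Nonempty) :
    vectorSpan ℝ (U ∩ {x | inner ℝ a x < b}) = vectorSpan ℝ U := by
  refine le_antisymm (vectorSpan_mono ℝ Set.inter_subset_left) ?_
  obtain ⟨p, hp⟩ := hne
  rw [vectorSpan_eq_span_vsub_set_right ℝ hp.1, Submodule.span_le]
  rintro _ ⟨x, hx, rfl⟩
  obtain ⟨t, ht, ht1, h⟩ := exists_small_step (β := inner ℝ a x - inner ℝ a p)
    (show inner ℝ a p < b from hp.2)
  have hmem : p + t • (x - p) ∈ U ∩ {x | inner ℝ a x < b} :=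
    ⟨convex_step hU.1 hp.1 hx ht.le ht1, by
      rw [Set.mem_ofPred_eq, inner_add_smul_sub]; exact h t ht.le le_rfl⟩
  have h1 := vsub_mem_vectorSpan ℝ hmem hp
  rw [vsub_eq_sub, add_sub_cancel_left] at h1
  exact (Submodule.smul_mem_iff _ ht.ne').1 h1

theorem RelOpen.vectorSpan_inter_gt {U : Set V} (hU : RelOpen U) {a : V} {b : ℝ}
    (hne : (U ∩ {x | b < inner ℝ a x}).Nonempty) :
    vectorSpan ℝ (U ∩ {x | b < inner ℝ a x}) = vectorSpan ℝ U := by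
  have := hU.vectorSpan_inter_lt (a := -a) (b := -b)
  simp only [inner_neg_left, neg_lt_neg_iff] at this
  exact this hne

theorem RelOpen.vectorSpan_inter_eq {U : Set V} (hU : RelOpen U) {a : V} {b : ℝ}
    (hne : (U ∩ {x | inner ℝ a x = b}).Nonempty) :
    vectorSpan ℝ (U ∩ {x | inner ℝ a x = b}) = vectorSpan ℝ U ⊓ LinearMap.ker (innerₛₗ ℝ a) := by
  obtain ⟨p, hp⟩ := hne
  have hpb : inner ℝ a p = b := hp.2
  apply le_antisymm
  · refine le_inf (vectorSpan_mono ℝ Set.inter_subset_left) ?_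
    rw [vectorSpan_eq_span_vsub_set_right ℝ hp, Submodule.span_le]
    rintro _ ⟨x, hx, rfl⟩
    have hxb : inner ℝ a x = b := hx.2
    simp [inner_sub_right, hpb, hxb]
  · rintro w ⟨hw, hw0⟩
    have hw0' : inner ℝ a w = 0 := by simpa using hw0
    obtain ⟨t, ht, htw⟩ := hU.exists_add_smul_mem hp.1 hw
    have hmem : p + t • w ∈ U ∩ {x | inner ℝ a x = b} :=
      ⟨htw, by simp [inner_add_right, inner_smul_right, hw0', hpb]⟩
    have h1 := vsub_mem_vectorSpan ℝ hmem hp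
    rw [vsub_eq_sub, add_sub_cancel_left] at h1
    exact (Submodule.smul_mem_iff _ ht.ne').1 h1

theorem finrank_inf_ker_add_one [FiniteDimensional ℝ V] (K : Submodule ℝ V) (f : V →ₗ[ℝ] ℝ)
    (h : ∃ v ∈ K, f v ≠ 0) :
    Module.finrank ℝ ↥(K ⊓ LinearMap.ker f) + 1 = Module.finrank ℝ K := by
  obtain ⟨v, hv, hfv⟩ := h
  have h1 := LinearMap.finrank_range_add_finrank_ker (f.domRestrict K)
  have h2 : LinearMap.range (f.domRestrict K) = ⊤ :=
    LinearMap.range_eq_top.2 (LinearMap.surjective (fun h0 => hfv (LinearMap.congr_fun h0 ⟨v, hv⟩)))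
  rw [h2, finrank_top, Module.finrank_self, LinearMap.ker_domRestrict] at h1
  rw [← Submodule.map_comap_subtype, Submodule.finrank_map_subtype_eq]
  omega

/-- A relatively open set lies on one side of a hyperplane, in it, or is cut by it. -/
theorem RelOpen.cut_cases [FiniteDimensional ℝ V] {U : Set V} (hU : RelOpen U) (a : V) (b : ℝ) :
    (∀ x ∈ U, inner ℝ a x < b) ∨ (∀ x ∈ U, inner ℝ a x = b) ∨ (∀ x ∈ U, b < inner ℝ a x) ∨
    ((U ∩ {x | inner ℝ a x < b}).Nonempty ∧ (U ∩ {x | inner ℝ a x = b}).Nonempty ∧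
      (U ∩ {x | b < inner ℝ a x}).Nonempty ∧
      Module.finrank ℝ (vectorSpan ℝ (U ∩ {x | inner ℝ a x < b}))
        = Module.finrank ℝ (vectorSpan ℝ U) ∧
      Module.finrank ℝ (vectorSpan ℝ (U ∩ {x | inner ℝ a x = b})) + 1
        = Module.finrank ℝ (vectorSpan ℝ U) ∧
      Module.finrank ℝ (vectorSpan ℝ (U ∩ {x | b < inner ℝ a x}))
        = Module.finrank ℝ (vectorSpan ℝ U)) := by
  -- prolonging a segment from `y` to `x ∈ H` beyond `x` crosses the hyperplane
  have ext : ∀ x ∈ U, ∀ y ∈ U, ∃ w ∈ U, ∃ t : ℝ, 0 < t ∧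
      inner ℝ a w = inner ℝ a x + t * (inner ℝ a x - inner ℝ a y) := by
    intro x hx y hy
    obtain ⟨t, ht, h⟩ := hU.2 x hx y hy
    exact ⟨_, h, t, ht, by simp only [inner_add_right, inner_smul_right, inner_sub_right]⟩
  by_cases h1 : ∀ x ∈ U, inner ℝ a x < b
  · exact Or.inl h1
  by_cases h2 : ∀ x ∈ U, inner ℝ a x = b
  · exact Or.inr (Or.inl h2)
  by_cases h3 : ∀ x ∈ U, b < inner ℝ a x
  · exact Or.inr (Or.inr (Or.inl h3))
  push Not at h1 h2 h3
  obtain ⟨p, hp, hpb⟩ : ∃ p ∈ U, inner ℝ a p < b := by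
    obtain ⟨x, hx, hxb⟩ := h3
    rcases hxb.lt_or_eq with h | h
    · exact ⟨x, hx, h⟩
    obtain ⟨y, hy, hyb⟩ := h2
    rcases hyb.lt_or_gt with h' | h'
    · exact ⟨y, hy, h'⟩
    obtain ⟨w, hw, t, ht, hwt⟩ := ext x hx y hy
    exact ⟨w, hw, by nlinarith⟩
  obtain ⟨q, hq, hqb⟩ : ∃ q ∈ U, b < inner ℝ a q := by
    obtain ⟨x, hx, hxb⟩ := h1
    rcases hxb.lt_or_eq with h | h
    · exact ⟨x, hx, h⟩
    obtain ⟨y, hy, hyb⟩ := h2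
    rcases hyb.lt_or_gt with h' | h'
    · obtain ⟨w, hw, t, ht, hwt⟩ := ext x hx y hy
      exact ⟨w, hw, by nlinarith⟩
    · exact ⟨y, hy, h'⟩
  have hlt : (U ∩ {x | inner ℝ a x < b}).Nonempty := ⟨p, hp, hpb⟩
  have hgt : (U ∩ {x | b < inner ℝ a x}).Nonempty := ⟨q, hq, hqb⟩
  have heq : (U ∩ {x | inner ℝ a x = b}).Nonempty := by
    have hd : 0 < inner ℝ a q - inner ℝ a p := by linarith
    refine ⟨p + ((b - inner ℝ a p) / (inner ℝ a q - inner ℝ a p)) • (q - p),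
      convex_step hU.1 hp hq (div_nonneg (by linarith) hd.le) ((div_le_one hd).2 (by linarith)), ?_⟩
    rw [Set.mem_ofPred_eq, inner_add_smul_sub, div_mul_cancel₀ _ hd.ne']
    ring
  refine Or.inr (Or.inr (Or.inr ⟨hlt, heq, hgt, ?_, ?_, ?_⟩))
  · rw [hU.vectorSpan_inter_lt hlt]
  · rw [hU.vectorSpan_inter_eq heq]
    refine finrank_inf_ker_add_one _ _ ⟨q - p, vsub_mem_vectorSpan ℝ hq hp, ?_⟩
    simp only [innerₛₗ_apply_apply, inner_sub_right]
    linarith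
  · rw [hU.vectorSpan_inter_gt hgt]

/-! ### Normal functionals and critical points -/

/-- The functional `⟨c, ·⟩` attains its maximum over `Q` at all points of `U`. -/
def IsNormal (Q U : Set V) (c : V) : Prop := ∀ x ∈ Q, ∀ u ∈ U, inner ℝ c x ≤ inner ℝ c u

/-- Some point `y` of the radial closure of `U` has `y - z` normal to `Q` along `U`. -/
def Critical (z : V) (Q U : Set V) : Prop := ∃ y ∈ radialClosure U, IsNormal Q U (y - z)

theorem IsNormal.inner_eq {Q U : Set V} {c : V} (h : IsNormal Q U c) (hUQ : U ⊆ Q) {u v : V}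
    (hu : u ∈ U) (hv : v ∈ U) : inner ℝ c u = inner ℝ c v :=
  le_antisymm (h u (hUQ hu) v hv) (h v (hUQ hv) u hu)

theorem IsNormal.inner_radialClosure {Q U : Set V} {c : V} (h : IsNormal Q U c) (hUQ : U ⊆ Q)
    {u y : V} (hu : u ∈ U) (hy : y ∈ radialClosure U) : inner ℝ c y = inner ℝ c u :=
  inner_eq_of_mem_radialClosure ⟨u, hu⟩ (fun _ hx => h.inner_eq hUQ hx hu) hy

/-- Each normal functional is constant on the radial closure, so `y - z` and `y' - z` are both
orthogonal to `y - y'`; subtracting gives `‖y - y'‖² = 0`. -/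
theorem IsNormal.unique {Q U : Set V} {z y y' : V} (hUQ : U ⊆ Q) (hne : U.Nonempty)
    (hy : y ∈ radialClosure U) (h : IsNormal Q U (y - z))
    (hy' : y' ∈ radialClosure U) (h' : IsNormal Q U (y' - z)) : y = y' := by
  obtain ⟨u, hu⟩ := hne
  have h1 := h.inner_radialClosure hUQ hu hy
  have h2 := h.inner_radialClosure hUQ hu hy'
  have h3 := h'.inner_radialClosure hUQ hu hy
  have h4 := h'.inner_radialClosure hUQ hu hy'
  have h5 : inner ℝ (y - y') (y - y') = 0 := by
    have h0 : inner ℝ (y - y') (y - y') = inner ℝ (y - z) (y - y') - inner ℝ (y' - z) (y - y') := by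
      rw [← inner_sub_left, sub_sub_sub_cancel_right]
    rw [h0, inner_sub_right, inner_sub_right]
    linarith
  exact sub_eq_zero.1 (inner_self_eq_zero.1 h5)

/-- A functional maximal over `Q` at one point of a relatively open `U ⊆ Q` is constant on `U`:
otherwise prolonging a segment beyond that point would increase it. -/
theorem isNormal_of_subset {Q U W : Set V} (hU : RelOpen U) (hUQ : U ⊆ Q) (hWU : W ⊆ U)
    (hne : W.Nonempty) {c : V} : IsNormal Q W c ↔ IsNormal Q U c := by
  refine ⟨fun h x hx u hu => ?_, fun h x hx u hu => h x hx u (hWU hu)⟩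
  obtain ⟨v, hv⟩ := hne
  obtain ⟨t, ht, htU⟩ := hU.2 v (hWU hv) u hu
  refine (h x hx v hv).trans ?_
  have := h _ (hUQ htU) v hv
  simp only [inner_add_right, inner_smul_right, inner_sub_right] at this
  nlinarith

/-- Normality is local: a violation at `x` also occurs on the segment close to `u`, where the extra
inequality is strict. -/
theorem isNormal_inter_le {Q U : Set V} (hQ : Convex ℝ Q) (hUQ : U ⊆ Q) {a : V} {b : ℝ}
    (hU : ∀ x ∈ U, inner ℝ a x < b) {c : V} :
    IsNormal (Q ∩ {x | inner ℝ a x ≤ b}) U c ↔ IsNormal Q U c := by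
  refine ⟨fun h x hx u hu => ?_, fun h x hx u hu => h x hx.1 u hu⟩
  obtain ⟨t, ht, ht1, hs⟩ := exists_small_step (β := inner ℝ a x - inner ℝ a u) (hU u hu)
  have := h (u + t • (x - u)) ⟨convex_step hQ (hUQ hu) hx ht.le ht1, by
    rw [Set.mem_ofPred_eq, inner_add_smul_sub]; exact (hs t ht.le le_rfl).le⟩ u hu
  rw [inner_add_smul_sub] at this
  nlinarith

theorem isNormal_inter_ge {Q U : Set V} (hQ : Convex ℝ Q) (hUQ : U ⊆ Q) {a : V} {b : ℝ}
    (hU : ∀ x ∈ U, b < inner ℝ a x) {c : V} :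
    IsNormal (Q ∩ {x | b ≤ inner ℝ a x}) U c ↔ IsNormal Q U c := by
  have := isNormal_inter_le hQ hUQ (a := -a) (b := -b) (c := c)
  simp only [inner_neg_left, neg_lt_neg_iff, neg_le_neg_iff] at this
  exact this hU

theorem isNormal_inter_union {Q U : Set V} (a : V) (b : ℝ) {c : V} :
    IsNormal Q U c ↔ IsNormal (Q ∩ {x | inner ℝ a x ≤ b}) U c ∧
      IsNormal (Q ∩ {x | b ≤ inner ℝ a x}) U c := by
  refine ⟨fun h => ⟨fun x hx => h x hx.1, fun x hx => h x hx.1⟩, fun h x hx => ?_⟩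
  rcases le_total (inner ℝ a x) b with hb | hb
  · exact h.1 x ⟨hx, hb⟩
  · exact h.2 x ⟨hx, hb⟩

/-- If both half-space conditions failed, at points on either side, the segment joining these points
would meet the hyperplane in a point violating normality there. With `isNormal_inter_union`, this is
inclusion-exclusion for normal cones. -/
theorem isNormal_inter_eq {Q U : Set V} (hQ : Convex ℝ Q) (hUQ : U ⊆ Q) {a : V} {b : ℝ}
    (hU : ∀ x ∈ U, inner ℝ a x = b) {c : V} :
    IsNormal (Q ∩ {x | inner ℝ a x = b}) U c ↔ IsNormal (Q ∩ {x | inner ℝ a x ≤ b}) U c ∨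
      IsNormal (Q ∩ {x | b ≤ inner ℝ a x}) U c := by
  constructor
  · intro h
    by_contra hcon
    simp only [not_or, IsNormal] at hcon
    push Not at hcon
    obtain ⟨⟨p, hp, u, hu, hpu⟩, ⟨q, hq, v, hv, hqv⟩⟩ := hcon
    rw [h.inner_eq (fun x hx => ⟨hUQ hx, hU x hx⟩) hv hu] at hqv
    have hpb : inner ℝ a p ≤ b := hp.2
    have hqb : b ≤ inner ℝ a q := hq.2
    rcases hpb.eq_or_lt with h0 | h0
    · exact absurd (h p ⟨hp.1, h0⟩ u hu) (not_le.2 hpu)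
    have hd : 0 < inner ℝ a q - inner ℝ a p := by linarith
    have h0' : 0 < (b - inner ℝ a p) / (inner ℝ a q - inner ℝ a p) :=
      div_pos (by linarith) hd
    have h1' : (b - inner ℝ a p) / (inner ℝ a q - inner ℝ a p) ≤ 1 :=
      (div_le_one hd).2 (by linarith)
    have := h (p + ((b - inner ℝ a p) / (inner ℝ a q - inner ℝ a p)) • (q - p))
      ⟨convex_step hQ hp.1 hq.1 h0'.le h1', by
        rw [Set.mem_ofPred_eq, inner_add_smul_sub, div_mul_cancel₀ _ hd.ne']; ring⟩ u hu
    rw [inner_add_smul_sub] at this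
    have h2 := mul_pos h0' (sub_pos.2 hqv)
    have h3 := mul_nonneg (sub_nonneg.2 h1') (sub_pos.2 hpu).le
    linarith
  · rintro (h | h) x ⟨hx, hxb⟩
    · exact h x ⟨hx, le_of_eq hxb⟩
    · exact h x ⟨hx, ge_of_eq hxb⟩

/-! ### Additivity of signs, weights and defects under cuts -/

open Classical in
/-- The sign `(-1) ^ dim U` of a nonempty set, and `0` for the empty set. -/
noncomputable def sign (U : Set V) : ℤ :=
  if U.Nonempty then (-1) ^ Module.finrank ℝ (vectorSpan ℝ U) else 0

open Classical in
/-- The sign of `U` if `U` is critical for `z` in `Q`, and `0` otherwise. -/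
noncomputable def weight (z : V) (Q U : Set V) : ℤ := if Critical z Q U then sign U else 0

@[simp] theorem sign_empty : sign (∅ : Set V) = 0 := by simp [sign]

@[simp] theorem weight_empty (z : V) (Q : Set V) : weight z Q ∅ = 0 := by simp [weight]

theorem sign_cross [FiniteDimensional ℝ V] {U : Set V} (hU : RelOpen U) {a : V} {b : ℝ}
    (h1 : (U ∩ {x | inner ℝ a x < b}).Nonempty) (h2 : (U ∩ {x | b ≤ inner ℝ a x}).Nonempty)
    (h3 : ¬ ∀ x ∈ U, inner ℝ a x = b) :
    sign (U ∩ {x | inner ℝ a x < b}) = sign U ∧ sign (U ∩ {x | inner ℝ a x = b}) = -sign U ∧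
      sign (U ∩ {x | b < inner ℝ a x}) = sign U := by
  obtain ⟨p, hp, hpb⟩ := h1
  obtain ⟨q, hq, hqb⟩ := h2
  rw [Set.mem_ofPred_eq] at hpb hqb
  rcases hU.cut_cases a b with h | h | h | ⟨hl, he, hg, dl, de, dg⟩
  · exact absurd (h q hq) (not_lt.2 hqb)
  · exact absurd h h3
  · exact absurd (h p hp) (not_lt.2 hpb.le)
  · rw [sign, sign, sign, sign, if_pos hl, if_pos he, if_pos hg, if_pos ⟨p, hp⟩, dl, dg, ← de]
    refine ⟨rfl, ?_, rfl⟩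
    rw [pow_succ]; ring

theorem inter_eq_empty_of {X : Type*} {U : Set X} {P R : X → Prop} (hU : ∀ x ∈ U, P x)
    (h : ∀ x, P x → ¬ R x) : U ∩ {x | R x} = ∅ :=
  Set.eq_empty_of_forall_notMem fun x hx => h x (hU x hx.1) hx.2

/-- A function on sets that vanishes at `∅` is additive on trivial cuts. -/
theorem add_cut_of_trivial (f : Set V → ℤ) (hf : f ∅ = 0) {U : Set V} {a : V} {b : ℝ}
    (h : (∀ x ∈ U, inner ℝ a x < b) ∨ (∀ x ∈ U, inner ℝ a x = b) ∨
      (∀ x ∈ U, b < inner ℝ a x)) :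
    f U = f (U ∩ {x | inner ℝ a x < b}) + f (U ∩ {x | inner ℝ a x = b})
      + f (U ∩ {x | b < inner ℝ a x}) := by
  rcases h with h | h | h
  · rw [Set.inter_eq_left.2 (show U ⊆ {x | inner ℝ a x < b} from h),
      inter_eq_empty_of h fun x hx => hx.ne,
      inter_eq_empty_of h fun x hx => hx.not_gt, hf]
    ring
  · rw [inter_eq_empty_of h fun x hx => hx.not_lt,
      Set.inter_eq_left.2 (show U ⊆ {x | inner ℝ a x = b} from h),
      inter_eq_empty_of h fun x hx => hx.not_gt, hf]
    ring
  · rw [inter_eq_empty_of h fun x hx => hx.not_gt, inter_eq_empty_of h fun x hx => hx.ne',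
      Set.inter_eq_left.2 (show U ⊆ {x | b < inner ℝ a x} from h), hf]
    ring

theorem sign_cut [FiniteDimensional ℝ V] {U : Set V} (hU : RelOpen U) (a : V) (b : ℝ) :
    sign U = sign (U ∩ {x | inner ℝ a x < b}) + sign (U ∩ {x | inner ℝ a x = b})
      + sign (U ∩ {x | b < inner ℝ a x}) := by
  rcases hU.cut_cases a b with h | h | h | ⟨hl, he, hg, dl, de, dg⟩
  · exact add_cut_of_trivial _ sign_empty (Or.inl h)
  · exact add_cut_of_trivial _ sign_empty (Or.inr (Or.inl h))
  · exact add_cut_of_trivial _ sign_empty (Or.inr (Or.inr h))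
  · rw [sign, sign, sign, sign, if_pos hl, if_pos he, if_pos hg,
      if_pos (hl.mono Set.inter_subset_left), dl, dg, ← de, pow_succ]
    ring

/-- By uniqueness, a known critical point of the larger configuration is the only candidate for the
smaller one. -/
theorem critical_iff_of_witness {Q Q' U W : Set V} {z y : V} (hUQ : U ⊆ Q)
    (hWU : W ⊆ U) (hne : W.Nonempty) (hcl : radialClosure W ⊆ radialClosure U)
    (hQ : ∀ c, IsNormal Q' W c → IsNormal Q U c)
    (hy : y ∈ radialClosure U) (h : IsNormal Q U (y - z)) :
    Critical z Q' W ↔ y ∈ radialClosure W ∧ IsNormal Q' W (y - z) := by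
  refine ⟨?_, fun h => ⟨y, h.1, h.2⟩⟩
  rintro ⟨y', hy', h'⟩
  rw [IsNormal.unique hUQ (hne.mono hWU) hy h (hcl hy') (hQ _ h')]
  exact ⟨hy', h'⟩

/-- All pieces share the normality condition of `U`, so only the position of its unique critical
point matters. Off the hyperplane, just the piece on that side is critical and it has the sign of
`U`; on the hyperplane all three are, and `s - s + s = s`. -/
theorem weight_cut [FiniteDimensional ℝ V] (z : V) {Q U : Set V} (hU : RelOpen U) (hUQ : U ⊆ Q)
    (a : V) (b : ℝ) :
    weight z Q U = weight z Q (U ∩ {x | inner ℝ a x < b})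
      + weight z Q (U ∩ {x | inner ℝ a x = b}) + weight z Q (U ∩ {x | b < inner ℝ a x}) := by
  rcases hU.cut_cases a b with h | h | h | ⟨hl, he, hg, dl, de, dg⟩
  · exact add_cut_of_trivial _ (weight_empty z Q) (Or.inl h)
  · exact add_cut_of_trivial _ (weight_empty z Q) (Or.inr (Or.inl h))
  · exact add_cut_of_trivial _ (weight_empty z Q) (Or.inr (Or.inr h))
  · have key : ∀ W : Set V, (U ∩ W).Nonempty → ∀ c, IsNormal Q (U ∩ W) c ↔ IsNormal Q U c :=
      fun W hW c => isNormal_of_subset hU hUQ Set.inter_subset_left hW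
    have hs := sign_cross hU hl (hg.mono fun x hx => ⟨hx.1, (show b < inner ℝ a x from hx.2).le⟩)
      fun h => hl.elim fun x hx => hx.2.ne (h x hx.1)
    simp only [weight, hs.1, hs.2.1, hs.2.2]
    by_cases hc : Critical z Q U
    · obtain ⟨y, hy, hN⟩ := id hc
      have crit : ∀ W : Set V, (U ∩ W).Nonempty →
          (Critical z Q (U ∩ W) ↔ y ∈ radialClosure (U ∩ W)) := by
        intro W hW
        rw [critical_iff_of_witness hUQ Set.inter_subset_left hW
          (radialClosure_inter_subset hU hW) (fun c => (key W hW c).1) hy hN,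
          key W hW, and_iff_left hN]
      simp only [crit _ hl, crit _ he, crit _ hg, if_pos hc, mem_radialClosure_inter_lt hU hl,
        mem_radialClosure_inter_eq hU he, mem_radialClosure_inter_gt hU hg, hy, true_and]
      rcases lt_trichotomy (inner ℝ a y) b with h | h | h
      · simp [h.le, h.ne, not_le.2 h]
      · simp [h]
      · simp [h.le, h.ne', not_le.2 h]
    · have crit : ∀ W : Set V, (U ∩ W).Nonempty → ¬ Critical z Q (U ∩ W) := by
        rintro W hW ⟨y, hy, hN⟩
        exact hc ⟨y, radialClosure_inter_subset hU hW hy, (key W hW _).1 hN⟩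
      simp [hc, crit _ hl, crit _ he, crit _ hg]

theorem weight_inter_le (z : V) {Q U : Set V} (hQ : Convex ℝ Q) (hUQ : U ⊆ Q) {a : V} {b : ℝ}
    (hU : ∀ x ∈ U, inner ℝ a x < b) :
    weight z (Q ∩ {x | inner ℝ a x ≤ b}) U = weight z Q U := by
  have h : Critical z (Q ∩ {x | inner ℝ a x ≤ b}) U ↔ Critical z Q U := by
    simp only [Critical, isNormal_inter_le hQ hUQ hU]
  classical exact if_congr h rfl rfl

theorem weight_inter_ge (z : V) {Q U : Set V} (hQ : Convex ℝ Q) (hUQ : U ⊆ Q) {a : V} {b : ℝ}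
    (hU : ∀ x ∈ U, b < inner ℝ a x) :
    weight z (Q ∩ {x | b ≤ inner ℝ a x}) U = weight z Q U := by
  have h : Critical z (Q ∩ {x | b ≤ inner ℝ a x}) U ↔ Critical z Q U := by
    simp only [Critical, isNormal_inter_ge hQ hUQ hU]
  classical exact if_congr h rfl rfl

/-- Any critical point for one of the four polyhedra is the one for the section, the smallest of
them. At that point, normality for `Q` is the conjunction of normality for the two halves, and
normality for the section is their disjunction. -/
theorem weight_inter_eq (z : V) {Q U : Set V} (hUo : RelOpen U) (hQ : Convex ℝ Q) (hUQ : U ⊆ Q)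
    {a : V} {b : ℝ} (hU : ∀ x ∈ U, inner ℝ a x = b) :
    weight z (Q ∩ {x | inner ℝ a x ≤ b}) U + weight z (Q ∩ {x | b ≤ inner ℝ a x}) U
      = weight z Q U + weight z (Q ∩ {x | inner ℝ a x = b}) U := by
  rcases U.eq_empty_or_nonempty with rfl | hne
  · simp
  have hsub : U ⊆ Q ∩ {x | inner ℝ a x = b} := fun x hx => ⟨hUQ hx, hU x hx⟩
  have hle : Q ∩ {x | inner ℝ a x = b} ⊆ Q ∩ {x | inner ℝ a x ≤ b} := fun x hx => ⟨hx.1, hx.2.le⟩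
  have hge : Q ∩ {x | inner ℝ a x = b} ⊆ Q ∩ {x | b ≤ inner ℝ a x} := fun x hx => ⟨hx.1, hx.2.ge⟩
  by_cases hc : Critical z (Q ∩ {x | inner ℝ a x = b}) U
  · obtain ⟨y, hy, hN⟩ := id hc
    have crit : ∀ Q', Q ∩ {x | inner ℝ a x = b} ⊆ Q' →
        (Critical z Q' U ↔ IsNormal Q' U (y - z)) := by
      intro Q' hQ'
      rw [critical_iff_of_witness hsub subset_rfl hne subset_rfl
        (fun c h x hx => h x (hQ' hx)) hy hN, and_iff_right hy]
    have h1 := isNormal_inter_union (Q := Q) (U := U) a b (c := y - z)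
    have h2 := (isNormal_inter_eq hQ hUQ hU).1 hN
    simp only [weight, if_pos hc, crit _ hle, crit _ hge, crit _ Set.inter_subset_left, h1]
    by_cases h3 : IsNormal (Q ∩ {x | inner ℝ a x ≤ b}) U (y - z) <;>
      by_cases h4 : IsNormal (Q ∩ {x | b ≤ inner ℝ a x}) U (y - z) <;> simp_all
  · have crit : ∀ Q', Q ∩ {x | inner ℝ a x = b} ⊆ Q' → ¬ Critical z Q' U := by
      rintro Q' hQ' ⟨y, hy, hN⟩
      exact hc ⟨y, hy, fun x hx => hN x (hQ' hx)⟩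
    simp only [weight, if_neg hc, if_neg (crit _ hle), if_neg (crit _ hge),
       if_neg (crit _ Set.inter_subset_left)]

/-- The defect of `U` in `Q`: its critical sign minus its sign. -/
noncomputable def defect (z : V) (Q U : Set V) : ℤ := weight z Q U - sign U

@[simp] theorem defect_empty (z : V) (Q : Set V) : defect z Q ∅ = 0 := by simp [defect]

/-- The defects of the two halves of `Q` add up to those of `Q` and of the cut. -/
theorem defect_cut [FiniteDimensional ℝ V] (z : V) {Q U : Set V} (hU : RelOpen U)
    (hQ : Convex ℝ Q) (hUQ : U ⊆ Q) (a : V) (b : ℝ) :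
    (defect z (Q ∩ {x | inner ℝ a x ≤ b}) (U ∩ {x | inner ℝ a x < b})
        + defect z (Q ∩ {x | inner ℝ a x ≤ b}) (U ∩ {x | inner ℝ a x = b}))
      + (defect z (Q ∩ {x | b ≤ inner ℝ a x}) (U ∩ {x | b < inner ℝ a x})
        + defect z (Q ∩ {x | b ≤ inner ℝ a x}) (U ∩ {x | inner ℝ a x = b}))
      = defect z Q U + defect z (Q ∩ {x | inner ℝ a x = b}) (U ∩ {x | inner ℝ a x = b}) := by
  have h0 := sign_cut hU a b
  have h1 := weight_cut z hU hUQ a b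
  have hsub : ∀ W, U ∩ W ⊆ Q := fun W => Set.inter_subset_left.trans hUQ
  have h2 := weight_inter_le z hQ (hsub {x | inner ℝ a x < b}) (a := a) (b := b) fun x hx => hx.2
  have h3 := weight_inter_ge z hQ (hsub {x | b < inner ℝ a x}) (a := a) (b := b) fun x hx => hx.2
  have h4 := weight_inter_eq z (hU.inter (relOpen_eq a b)) hQ (hsub {x | inner ℝ a x = b})
    (a := a) (b := b) fun x hx => hx.2
  simp only [defect]
  linarith

/-! ### Cells of a polyhedron and the total defect -/

variable {ι : Type*}

/-- The polyhedron cut out of `A` by the inequalities indexed by `S`. -/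
def polyhedron (a : ι → V) (b : ι → ℝ) (A : Set V) (S : Finset ι) : Set V :=
  {x | x ∈ A ∧ ∀ i ∈ S, inner ℝ (a i) x ≤ b i}

/-- The part of the polyhedron where, among the inequalities indexed by `S`, exactly those
indexed by `I` are tight. -/
def cell (a : ι → V) (b : ι → ℝ) (A : Set V) (S I : Finset ι) : Set V :=
  {x | x ∈ A ∧ (∀ i ∈ I, inner ℝ (a i) x = b i) ∧ ∀ i ∈ S, i ∉ I → inner ℝ (a i) x < b i}

/-- Negation of the entries of `f` with index in `K`. -/
def flip [DecidableEq ι] {X : Type*} [Neg X] (K : Finset ι) (f : ι → X) (i : ι) : X :=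
  if i ∈ K then -f i else f i

/-- The sum of the defects of all cells of a polyhedron. -/
noncomputable def totalDefect (z : V) (a : ι → V) (b : ι → ℝ) (A : Set V) (S : Finset ι) : ℤ :=
  ∑ I ∈ S.powerset, defect z (polyhedron a b A S) (cell a b A S I)

theorem RelOpen.forall_mem (P : ι → V → Prop) (S : Finset ι)
    (h : ∀ i ∈ S, RelOpen {x | P i x}) : RelOpen {x | ∀ i ∈ S, P i x} := by
  classical
  induction S using Finset.induction_on with
  | empty =>
    simpa using relOpen_affineSubspace (⊤ : AffineSubspace ℝ V)
  | insert j S _ ih =>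
    have := (h j (Finset.mem_insert_self _ _)).inter
      (ih fun i hi => h i (Finset.mem_insert_of_mem hi))
    simp only [Finset.forall_mem_insert]
    exact this

theorem relOpen_cell (a : ι → V) (b : ι → ℝ) {A : Set V} (hA : RelOpen A) (S I : Finset ι) :
    RelOpen (cell a b A S I) := by
  refine hA.inter (RelOpen.inter (RelOpen.forall_mem _ _ fun i _ => relOpen_eq _ _)
    (RelOpen.forall_mem _ _ fun i _ => ?_))
  by_cases hi : i ∈ I
  · simpa [hi] using relOpen_affineSubspace (⊤ : AffineSubspace ℝ V)
  · simpa [hi] using relOpen_lt (a i) (b i)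

theorem convex_polyhedron (a : ι → V) (b : ι → ℝ) {A : Set V} (hA : Convex ℝ A) (S : Finset ι) :
    Convex ℝ (polyhedron a b A S) := by
  intro x hx y hy s t hs ht hst
  exact ⟨hA hx.1 hy.1 hs ht hst,
    fun i hi => convex_le (a i) (b i) (hx.2 i hi) (hy.2 i hi) hs ht hst⟩

theorem cell_subset_polyhedron (a : ι → V) (b : ι → ℝ) (A : Set V) (S I : Finset ι) :
    cell a b A S I ⊆ polyhedron a b A S := by
  refine fun x hx => ⟨hx.1, fun i hi => ?_⟩
  by_cases h : i ∈ I
  · exact (hx.2.1 i h).le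
  · exact (hx.2.2 i hi h).le

theorem cell_inter (a : ι → V) (b : ι → ℝ) (A X : Set V) (S I : Finset ι) :
    cell a b (A ∩ X) S I = cell a b A S I ∩ X := by
  ext x; simp only [cell, Set.mem_inter_iff, Set.mem_ofPred_eq]; tauto

theorem polyhedron_inter (a : ι → V) (b : ι → ℝ) (A X : Set V) (S : Finset ι) :
    polyhedron a b (A ∩ X) S = polyhedron a b A S ∩ X := by
  ext x; simp only [polyhedron, Set.mem_inter_iff, Set.mem_ofPred_eq]; tauto

theorem polyhedron_insert [DecidableEq ι] (a : ι → V) (b : ι → ℝ) (A : Set V) (j : ι)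
    (S : Finset ι) :
    polyhedron a b A (insert j S) = polyhedron a b A S ∩ {x | inner ℝ (a j) x ≤ b j} := by
  ext x
  simp only [polyhedron, Set.mem_inter_iff, Set.mem_ofPred_eq, Finset.forall_mem_insert]
  tauto

theorem cell_insert_of_notMem [DecidableEq ι] (a : ι → V) (b : ι → ℝ) (A : Set V) {j : ι}
    (S : Finset ι)
    {I : Finset ι} (hj : j ∉ I) :
    cell a b A (insert j S) I = cell a b A S I ∩ {x | inner ℝ (a j) x < b j} := by
  ext x
  simp only [cell, Set.mem_inter_iff, Set.mem_ofPred_eq, Finset.forall_mem_insert]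
  tauto

theorem cell_insert_insert [DecidableEq ι] (a : ι → V) (b : ι → ℝ) (A : Set V) {j : ι}
    {S : Finset ι}
    (I : Finset ι) (hj : j ∉ S) :
    cell a b A (insert j S) (insert j I) = cell a b A S I ∩ {x | inner ℝ (a j) x = b j} := by
  ext x
  simp only [cell, Set.mem_inter_iff, Set.mem_ofPred_eq, Finset.mem_insert, not_or]
  constructor
  · rintro ⟨hA, hI, hS⟩
    exact ⟨⟨hA, fun i hi => hI i (Or.inr hi), fun i hi hiI =>
      hS i (Or.inr hi) ⟨fun h => hj (h ▸ hi), hiI⟩⟩, hI j (Or.inl rfl)⟩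
  · rintro ⟨⟨hA, hI, hS⟩, hxj⟩
    refine ⟨hA, ?_, ?_⟩
    · rintro i (rfl | hi)
      exacts [hxj, hI i hi]
    · rintro i (rfl | hi) ⟨h, h'⟩
      exacts [absurd rfl h, hS i hi h']

theorem polyhedron_congr {a a' : ι → V} {b b' : ι → ℝ} (A : Set V) {S : Finset ι}
    (ha : ∀ i ∈ S, a i = a' i) (hb : ∀ i ∈ S, b i = b' i) :
    polyhedron a b A S = polyhedron a' b' A S := by
  ext x
  refine and_congr_right fun _ => forall₂_congr fun i hi => ?_
  rw [ha i hi, hb i hi]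

theorem cell_congr {a a' : ι → V} {b b' : ι → ℝ} (A : Set V) {S I : Finset ι} (hI : I ⊆ S)
    (ha : ∀ i ∈ S, a i = a' i) (hb : ∀ i ∈ S, b i = b' i) :
    cell a b A S I = cell a' b' A S I := by
  ext x
  refine and_congr_right fun _ => and_congr (forall₂_congr fun i hi => ?_)
    (forall₂_congr fun i hi => ?_)
  · rw [ha i (hI hi), hb i (hI hi)]
  · rw [ha i hi, hb i hi]

theorem totalDefect_insert [DecidableEq ι] (z : V) (a : ι → V) (b : ι → ℝ) (A : Set V) {j : ι}
    {S : Finset ι}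
    (hj : j ∉ S) :
    totalDefect z a b A (insert j S) = ∑ I ∈ S.powerset,
      (defect z (polyhedron a b A S ∩ {x | inner ℝ (a j) x ≤ b j})
          (cell a b A S I ∩ {x | inner ℝ (a j) x < b j})
        + defect z (polyhedron a b A S ∩ {x | inner ℝ (a j) x ≤ b j})
          (cell a b A S I ∩ {x | inner ℝ (a j) x = b j})) := by
  rw [totalDefect, Finset.sum_powerset_insert hj, ← Finset.sum_add_distrib, polyhedron_insert]
  refine Finset.sum_congr rfl fun I hI => ?_
  rw [cell_insert_of_notMem a b A S fun h => hj (Finset.mem_powerset.1 hI h),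
    cell_insert_insert a b A I hj]

/-- Reversing one inequality: the total defects of the two sides add up to those of the
polyhedron without this inequality and of its section by the hyperplane. -/
theorem totalDefect_add_flip [DecidableEq ι] [FiniteDimensional ℝ V] (z : V) (a : ι → V) (b : ι → ℝ)
    {A : Set V}
    (hA : RelOpen A) {j : ι} {S : Finset ι} (hj : j ∉ S) :
    totalDefect z a b A (insert j S)
        + totalDefect z (flip {j} a) (flip {j} b) A (insert j S)
      = totalDefect z a b A S + totalDefect z a b (A ∩ {x | inner ℝ (a j) x = b j}) S := by
  have ha : ∀ i ∈ S, flip {j} a i = a i := fun i hi => by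
    rw [flip, if_neg]; rintro h; exact hj (Finset.mem_singleton.1 h ▸ hi)
  have hb : ∀ i ∈ S, flip {j} b i = b i := fun i hi => by
    rw [flip, if_neg]; rintro h; exact hj (Finset.mem_singleton.1 h ▸ hi)
  have haj : flip {j} a j = -a j := by simp [flip]
  have hbj : flip {j} b j = -b j := by simp [flip]
  rw [totalDefect_insert z a b A hj, totalDefect_insert z _ _ A hj, totalDefect, totalDefect,
    ← Finset.sum_add_distrib, ← Finset.sum_add_distrib]
  refine Finset.sum_congr rfl fun I hI => ?_
  rw [polyhedron_congr A ha hb, cell_congr A (Finset.mem_powerset.1 hI) ha hb, haj, hbj,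
    polyhedron_inter, cell_inter]
  simp only [inner_neg_left, neg_lt_neg_iff, neg_le_neg_iff, neg_inj]
  exact defect_cut z (relOpen_cell a b hA S I) (convex_polyhedron a b hA.1 S)
    (cell_subset_polyhedron a b A S I) (a j) (b j)

theorem flip_empty [DecidableEq ι] {X : Type*} [Neg X] (f : ι → X) : flip ∅ f = f := by
  funext i; simp [flip]

theorem flip_insert [DecidableEq ι] {X : Type*} [Neg X] {K : Finset ι} {j : ι} (hj : j ∉ K)
    (f : ι → X) :
    flip (insert j K) f = flip {j} (flip K f) := by
  funext i
  by_cases h : i = j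
  · subst h; simp [flip, hj]
  · simp [flip, h]

/-- A polyhedron contained in one of its bounding hyperplanes. -/
theorem totalDefect_of_subset_hyperplane [DecidableEq ι] (z : V) (a : ι → V) (b : ι → ℝ) (A : Set V)
    {j : ι}
    {S : Finset ι} (hj : j ∉ S)
    (h : ∀ x ∈ polyhedron a b A (insert j S), inner ℝ (a j) x = b j) :
    totalDefect z a b A (insert j S) = totalDefect z a b (A ∩ {x | inner ℝ (a j) x = b j}) S := by
  rw [totalDefect_insert z a b A hj, totalDefect]
  rw [polyhedron_insert] at h
  have hQ : polyhedron a b A S ∩ {x | inner ℝ (a j) x ≤ b j}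
      = polyhedron a b A S ∩ {x | inner ℝ (a j) x = b j} :=
    Set.Subset.antisymm (fun x hx => ⟨hx.1, h x hx⟩) fun x hx => ⟨hx.1, le_of_eq hx.2⟩
  refine Finset.sum_congr rfl fun I hI => ?_
  have he : cell a b A S I ∩ {x | inner ℝ (a j) x < b j} = ∅ := by
    refine Set.eq_empty_of_forall_notMem fun x hx => ?_
    have hlt : inner ℝ (a j) x < b j := hx.2
    exact hlt.ne (h x ⟨cell_subset_polyhedron a b A S I hx.1, hlt.le⟩)
  rw [he, defect_empty, zero_add, polyhedron_inter, cell_inter, hQ]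

/-- If `y` lies in the radial closure of `U`, normality along `U` bounds the functional at `y`. -/
theorem IsNormal.inner_le {Q U : Set V} {c x y : V} (h : IsNormal Q U c) (hUQ : U ⊆ Q)
    (hne : U.Nonempty) (hx : x ∈ Q) (hy : y ∈ radialClosure U) : inner ℝ c x ≤ inner ℝ c y := by
  obtain ⟨u, hu⟩ := hne
  rw [h.inner_radialClosure hUQ hu hy]
  exact h x hx u hu

theorem mem_radialClosure_cell (a : ι → V) (b : ι → ℝ) {A : Set V} (hA : Convex ℝ A)
    {S I : Finset ι} {y : V} (hy : y ∈ polyhedron a b A S)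
    (hI : ∀ i ∈ I, inner ℝ (a i) y = b i) : y ∈ radialClosure (cell a b A S I) := by
  intro p hp t h0 h1
  refine ⟨convex_step hA hy.1 hp.1 h0.le h1, fun i hi => ?_, fun i hi hiI => ?_⟩
  · rw [inner_add_smul_sub, hI i hi, hp.2.1 i hi]; ring
  · rw [inner_add_smul_sub]
    have := hp.2.2 i hi hiI
    have := hy.2 i hi
    nlinarith

theorem radialClosure_cell_subset (a : ι → V) (b : ι → ℝ) (A : AffineSubspace ℝ V)
    {S I : Finset ι} (hne : (cell a b A S I).Nonempty) :
    radialClosure (cell a b A S I) ⊆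
      {y | y ∈ polyhedron a b A S ∧ ∀ i ∈ I, inner ℝ (a i) y = b i} := by
  intro y hy
  refine ⟨⟨?_, fun i hi => inner_le_of_mem_radialClosure hne
    (fun x hx => (cell_subset_polyhedron a b A S I hx).2 i hi) hy⟩,
    fun i hi => inner_eq_of_mem_radialClosure hne (fun x hx => hx.2.1 i hi) hy⟩
  obtain ⟨p, hp⟩ := hne
  -- The midpoint of `p` and `y` lies in `A`, and `y` is on the line through `p` and it, at
  -- parameter 2.
  have h := hy p hp (1 / 2) (by norm_num) (by norm_num)
  have := AffineMap.lineMap_mem (2 : ℝ) hp.1 h.1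
  have he : AffineMap.lineMap p (y + (1 / 2 : ℝ) • (p - y)) (2 : ℝ) = y := by
    rw [AffineMap.lineMap_apply, vsub_eq_sub, vadd_eq_add]
    match_scalars <;> norm_num
  rwa [he] at this

/-! ### Vanishing of the total defect -/

/-- The orthogonal projection onto `A`, characterised by its normal equation. -/
theorem exists_proj [FiniteDimensional ℝ V] (A : AffineSubspace ℝ V) (hA : (A : Set V).Nonempty)
    (z : V) : ∃ p ∈ A, ∀ v ∈ A.direction, inner ℝ (p - z) v = 0 := by
  have : Nonempty A := hA.to_subtype
  refine ⟨EuclideanGeometry.orthogonalProjection A z,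
    EuclideanGeometry.orthogonalProjection_mem z, fun v hv => ?_⟩
  have := EuclideanGeometry.orthogonalProjection_vsub_mem_direction_orthogonal A z
  rw [real_inner_comm]
  exact (Submodule.mem_orthogonal _ _).1 this v hv

/-- A polyhedron with total defect zero after all sign changes has total defect zero. -/
theorem totalDefect_eq_zero_of_flip [DecidableEq ι] [FiniteDimensional ℝ V] (z : V)
    (A : AffineSubspace ℝ V)
    {S : Finset ι}
    (ih : ∀ T ⊂ S, ∀ (a : ι → V) (b : ι → ℝ) (B : AffineSubspace ℝ V),
      totalDefect z a b B T = 0) {K : Finset ι} (hK : K ⊆ S) (a : ι → V) (b : ι → ℝ)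
    (h : totalDefect z (flip K a) (flip K b) A S = 0) : totalDefect z a b A S = 0 := by
  induction K using Finset.induction_on with
  | empty =>
    rwa [flip_empty, flip_empty] at h
  | insert j K hj ihK =>
    refine ihK ((Finset.subset_insert _ _).trans hK) ?_
    have hjS : j ∈ S := hK (Finset.mem_insert_self _ _)
    -- Both terms on the right involve fewer inequalities and vanish by induction, so the two
    -- orientations have opposite totals.
    have h1 := totalDefect_add_flip z (flip K a) (flip K b) (relOpen_affineSubspace A)
      (Finset.notMem_erase j S)
    rw [Finset.insert_erase hjS, ← flip_insert hj, ← flip_insert hj, h,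
      ih _ (Finset.erase_ssubset hjS)] at h1
    have h2 := ih _ (Finset.erase_ssubset hjS) (flip K a) (flip K b)
      (A ⊓ hyperplane (flip K a j) (flip K b j))
    have h3 : totalDefect z (flip K a) (flip K b)
        (↑A ∩ {x | inner ℝ (flip K a j) x = flip K b j}) (S.erase j) = 0 := h2
    rw [h3] at h1
    simpa using h1

/-- Functionals restricted to a subspace are jointly surjective or satisfy a linear relation. -/
theorem surjective_or_exists_relation [DecidableEq ι] (a : ι → V) (D : Submodule ℝ V)
    (S : Finset ι) :
    (∀ c : ι → ℝ, ∃ v ∈ D, ∀ i ∈ S, inner ℝ (a i) v = c i) ∨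
    ∃ l : ι → ℝ, (∃ j ∈ S, l j ≠ 0) ∧ ∀ v ∈ D, ∑ i ∈ S, l i * inner ℝ (a i) v = 0 := by
  let φ : D →ₗ[ℝ] (S → ℝ) := LinearMap.pi fun i => (innerₛₗ ℝ (a i)).domRestrict D
  by_cases h : LinearMap.range φ = ⊤
  · refine Or.inl fun c => ?_
    obtain ⟨v, hv⟩ := LinearMap.range_eq_top.1 h fun i => c i
    exact ⟨v, v.2, fun i hi => congrFun hv ⟨i, hi⟩⟩
  · obtain ⟨f, hf, hle⟩ := Submodule.exists_le_ker_of_lt_top _ (lt_top_iff_ne_top.2 h)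
    -- The coefficients are the values on the standard basis of a nonzero functional vanishing on
    -- the proper range.
    refine Or.inr ⟨fun i => if hi : i ∈ S then f (Pi.single ⟨i, hi⟩ 1) else 0, ?_, fun v hv => ?_⟩
    · by_contra hcon
      push Not at hcon
      refine hf (LinearMap.pi_ext' fun i => LinearMap.ext_ring ?_)
      have := hcon i i.2
      rw [dif_pos i.2] at this
      simpa using this
    · have h0 : f (φ ⟨v, hv⟩) = 0 := hle (LinearMap.mem_range_self φ _)
      rw [LinearMap.pi_apply_eq_sum_univ] at h0
      refine Eq.trans ?_ h0
      rw [← Finset.sum_coe_sort S]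
      refine Finset.sum_congr rfl fun i _ => ?_
      beta_reduce
      rw [dif_pos i.2, smul_eq_mul, mul_comm]
      congr 2
      funext k
      simp [Pi.single_apply, eq_comm]

/-- In a simplicial cone, the signs of the faces cancel. -/
theorem sum_sign_cell_eq_zero [FiniteDimensional ℝ V] [DecidableEq ι] (a : ι → V) (b : ι → ℝ)
    (A : AffineSubspace ℝ V) {S : Finset ι} (hS : S.Nonempty)
    (hsurj : ∀ c : ι → ℝ, ∃ v ∈ A.direction, ∀ i ∈ S, inner ℝ (a i) v = c i)
    {x₀ : V} (hx₀ : x₀ ∈ A) (hx₀b : ∀ i ∈ S, inner ℝ (a i) x₀ = b i) :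
    ∑ I ∈ S.powerset, sign (cell a b A S I) = 0 := by
  obtain ⟨k, hk⟩ := hS
  rw [← Finset.insert_erase hk, Finset.sum_powerset_insert (Finset.notMem_erase k S),
    ← Finset.sum_add_distrib]
  refine Finset.sum_eq_zero fun I hI => ?_
  have hkI : k ∉ I := fun h => Finset.notMem_erase k S (Finset.mem_powerset.1 hI h)
  rw [cell_insert_of_notMem _ _ _ _ hkI, cell_insert_insert _ _ _ _ (Finset.notMem_erase k S)]
  have point : ∀ r : ℝ, ∃ x ∈ cell a b A (S.erase k) I, inner ℝ (a k) x = b k + r := by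
    intro r
    -- Starting at the apex, keep `I` tight, make the other constraints of `S.erase k` strict, and
    -- prescribe the `k`-th value. Both signs of `r` show that the hyperplane of `k` cuts the cell.
    obtain ⟨v, hv, hvc⟩ := hsurj fun i => if i = k then r else if i ∈ I then 0 else -1
    refine ⟨v +ᵥ x₀, ⟨AffineSubspace.vadd_mem_of_mem_direction hv hx₀, fun i hi => ?_,
      fun i hi hiI => ?_⟩, ?_⟩
    · have hiS := Finset.mem_erase.1 (Finset.mem_powerset.1 hI hi)
      rw [vadd_eq_add, inner_add_right, hvc i hiS.2, hx₀b i hiS.2, if_neg hiS.1, if_pos hi,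
        zero_add]
    · have hiS := Finset.mem_erase.1 hi
      rw [vadd_eq_add, inner_add_right, hvc i hiS.2, hx₀b i hiS.2, if_neg hiS.1, if_neg hiI]
      linarith
    · rw [vadd_eq_add, inner_add_right, hvc k hk, hx₀b k hk, if_pos rfl, add_comm]
  obtain ⟨x, hx, hxb⟩ := point (-1)
  obtain ⟨y, hy, hyb⟩ := point 1
  have := sign_cross (relOpen_cell a b (relOpen_affineSubspace A) (S.erase k) I)
    (a := a k) (b := b k) ⟨x, hx, by rw [Set.mem_ofPred_eq]; linarith⟩
    ⟨y, hy, by rw [Set.mem_ofPred_eq]; linarith⟩ fun h => by linarith [h y hy]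
  rw [this.1, this.2.1]
  ring

/-- A simplicial cone containing the reflection of the projection of `z` in its apex has no
critical faces. -/
theorem not_critical_cell (z : V) (a : ι → V) (b : ι → ℝ) (A : AffineSubspace ℝ V)
    {S I : Finset ι} {x₀ p : V} (hx₀ : x₀ ∈ A) (hx₀b : ∀ i ∈ S, inner ℝ (a i) x₀ = b i)
    (hp : p ∈ A) (hpz : ∀ v ∈ A.direction, inner ℝ (p - z) v = 0)
    (hpb : ∀ i ∈ S, b i ≤ inner ℝ (a i) p) (hne : ∃ k ∈ S, inner ℝ (a k) p ≠ b k)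
    (hU : (cell a b A S I).Nonempty) : ¬ Critical z (polyhedron a b A S) (cell a b A S I) := by
  rintro ⟨y, hy, hN⟩
  have hyQ := (radialClosure_cell_subset a b A hU hy).1
  have hle : ∀ x ∈ polyhedron a b A S, inner ℝ (y - p) (x - y) ≤ 0 := by
    intro x hx
    have h1 := hN.inner_le (cell_subset_polyhedron a b A S I) hU hx hy
    have h2 := hpz (x - y) (AffineSubspace.vsub_mem_direction hx.1 hyQ.1)
    have h3 : inner ℝ (y - p) (x - y) = inner ℝ (y - z) (x - y) - inner ℝ (p - z) (x - y) := by
      rw [← inner_sub_left, sub_sub_sub_cancel_right]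
    rw [h3, h2, inner_sub_right]
    linarith
  have hcone : ∀ r : ℝ, 0 ≤ r → r • (y - x₀) + x₀ ∈ polyhedron a b A S := by
    intro r hr
    refine ⟨A.smul_vsub_vadd_mem r hyQ.1 hx₀ hx₀, fun i hi => ?_⟩
    have := hyQ.2 i hi
    simp only [inner_add_right, inner_smul_right, inner_sub_right, hx₀b i hi]
    nlinarith
  -- With the apex as origin, the tests at `0` and `2 • Y` give `⟨Y - P, Y⟩ = 0`; the test at `-P`
  -- then gives `⟨Y - P, Y - P⟩ ≤ 0`. So `Y = P`, against the strict inequality at `k`.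
  have h0 := hle _ (hcone 0 le_rfl)
  have h2 := hle _ (hcone 2 zero_le_two)
  have hrefl : (-1 : ℝ) • (p - x₀) + x₀ ∈ polyhedron a b A S := by
    refine ⟨A.smul_vsub_vadd_mem (-1) hp hx₀ hx₀, fun i hi => ?_⟩
    have := hpb i hi
    simp only [inner_add_right, inner_smul_right, inner_sub_right, hx₀b i hi]
    linarith
  have h3 := hle _ hrefl
  obtain ⟨Y, rfl⟩ : ∃ Y, y = Y + x₀ := ⟨y - x₀, by abel⟩
  obtain ⟨P, rfl⟩ : ∃ P, p = P + x₀ := ⟨p - x₀, by abel⟩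
  have e : ∀ w : V, w + x₀ - (Y + x₀) = w - Y := fun w => by abel
  simp only [add_sub_cancel_right, e, add_sub_add_right_eq_sub] at h0 h2 h3
  simp only [zero_smul, neg_smul, one_smul, inner_sub_left, inner_sub_right, inner_neg_right,
    inner_smul_right, inner_zero_right] at h0 h2 h3
  have hc := real_inner_comm Y P
  have hYP : inner ℝ (Y - P) (Y - P) ≤ 0 := by
    simp only [inner_sub_left, inner_sub_right]
    linarith
  have hY : Y = P := sub_eq_zero.1 (real_inner_self_nonpos.1 hYP)
  subst hY
  obtain ⟨k, hk, hkb⟩ := hne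
  exact hkb (le_antisymm (hyQ.2 k hk) (hpb k hk))

/-- The induction must range over all `A`, since restricting to a bounding hyperplane trades an
inequality for a smaller ambient subspace. The base case `S = ∅` falls under the independent case,
with the projection of `z` as critical point. -/
theorem totalDefect_eq_zero [FiniteDimensional ℝ V] [DecidableEq ι] (z : V) (S : Finset ι) :
    ∀ (a : ι → V) (b : ι → ℝ) (A : AffineSubspace ℝ V), totalDefect z a b A S = 0 := by
  induction S using Finset.strongInduction with
  | H S ih =>
  intro a b A
  rcases (A : Set V).eq_empty_or_nonempty with hA | ⟨x₁, hx₁⟩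
  · refine Finset.sum_eq_zero fun I _ => ?_
    have : cell a b A S I = ∅ := Set.eq_empty_of_forall_notMem fun x hx => by
      have := hx.1
      rw [hA] at this
      exact this
    rw [this, defect_empty]
  rcases surjective_or_exists_relation a A.direction S with hsurj | ⟨l, ⟨j, hj, hlj⟩, hl⟩
  · obtain ⟨v, hv, hvb⟩ := hsurj fun i => b i - inner ℝ (a i) x₁
    obtain ⟨x₀, hx₀, hx₀b⟩ : ∃ x₀ ∈ A, ∀ i ∈ S, inner ℝ (a i) x₀ = b i :=
      ⟨v +ᵥ x₁, AffineSubspace.vadd_mem_of_mem_direction hv hx₁, fun i hi => by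
        rw [vadd_eq_add, inner_add_right, hvb i hi]; ring⟩
    obtain ⟨p, hp, hpz⟩ := exists_proj A ⟨x₁, hx₁⟩ z
    by_cases hpb : ∀ i ∈ S, inner ℝ (a i) p = b i
    · refine Finset.sum_eq_zero fun I hI => ?_
      have hcrit : Critical z (polyhedron a b A S) (cell a b A S I) := by
        refine ⟨p, mem_radialClosure_cell a b A.convex ⟨hp, fun i hi => (hpb i hi).le⟩
          fun i hi => hpb i (Finset.mem_powerset.1 hI hi), fun x hx u hu => ?_⟩
        have := hpz (x - u) (AffineSubspace.vsub_mem_direction hx.1 hu.1)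
        rw [inner_sub_right] at this
        linarith
      rw [defect, weight, if_pos hcrit, sub_self]
    · push Not at hpb
      obtain ⟨k, hk, hkb⟩ := hpb
      -- Reversing the inequalities strictly satisfied by `p` puts `p` on the wrong side of every
      -- constraint, hence its reflection in the apex inside the cone.
      let K := S.filter fun i => inner ℝ (a i) p < b i
      refine totalDefect_eq_zero_of_flip z A ih (K := K) (Finset.filter_subset _ _) a b ?_
      have hx₀' : ∀ i ∈ S, inner ℝ (flip K a i) x₀ = flip K b i := by
        intro i hi
        by_cases h : i ∈ K <;> simp [flip, h, hx₀b i hi]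
      have hw : ∀ I, weight z (polyhedron (flip K a) (flip K b) A S)
          (cell (flip K a) (flip K b) A S I) = 0 := by
        intro I
        rcases (cell (flip K a) (flip K b) A S I).eq_empty_or_nonempty with h | h
        · rw [h, weight_empty]
        rw [weight, if_neg]
        refine not_critical_cell z _ _ A hx₀ hx₀' hp hpz (fun i hi => ?_) ⟨k, hk, ?_⟩ h
        · by_cases h : i ∈ K
          · simp only [flip, h, if_true, inner_neg_left, neg_le_neg_iff]
            exact (Finset.mem_filter.1 h).2.le
          · simp only [flip, h, if_false]
            by_contra hlt
            exact h (Finset.mem_filter.2 ⟨hi, not_le.1 hlt⟩)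
        · by_cases h : k ∈ K <;> simpa [flip, h] using hkb
      simp only [totalDefect, defect, hw, zero_sub, Finset.sum_neg_distrib, neg_eq_zero]
      refine sum_sign_cell_eq_zero _ _ A ⟨k, hk⟩ (fun c => ?_) hx₀ hx₀'
      -- Independence survives sign changes: prescribe the sign-changed values.
      obtain ⟨v, hv, hvc⟩ := hsurj (flip K c)
      refine ⟨v, hv, fun i hi => ?_⟩
      have := hvc i hi
      by_cases h : i ∈ K
      · simp only [flip, h, if_true, inner_neg_left] at this ⊢
        linarith
      · simpa only [flip, h, if_false] using this
  · obtain ⟨l, hlj, hl⟩ : ∃ l : ι → ℝ, l j ≠ 0 ∧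
        ∀ x ∈ A, 0 ≤ ∑ i ∈ S, l i * (inner ℝ (a i) x - b i) := by
      -- The relation makes this sum constant on `A`; replacing `l` by `-l` if necessary makes it
      -- nonnegative.
      have hconst : ∀ x ∈ A, ∑ i ∈ S, l i * (inner ℝ (a i) x - b i)
          = ∑ i ∈ S, l i * (inner ℝ (a i) x₁ - b i) := by
        intro x hx
        rw [← sub_eq_zero, ← Finset.sum_sub_distrib,
          ← hl (x - x₁) (AffineSubspace.vsub_mem_direction hx hx₁)]
        refine Finset.sum_congr rfl fun i _ => ?_
        rw [inner_sub_right]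
        ring
      rcases le_total 0 (∑ i ∈ S, l i * (inner ℝ (a i) x₁ - b i)) with h | h
      · exact ⟨l, hlj, fun x hx => by rwa [hconst x hx]⟩
      · refine ⟨-l, neg_ne_zero.2 hlj, fun x hx => ?_⟩
        simp only [Pi.neg_apply, neg_mul, Finset.sum_neg_distrib, hconst x hx]
        linarith
    -- With these orientations every summand is nonpositive on the polyhedron while the sum is
    -- nonnegative, so all vanish and constraint `j` is tight. An empty polyhedron is included.
    let K := S.filter fun i => l i < 0
    refine totalDefect_eq_zero_of_flip z A ih (K := K) (Finset.filter_subset _ _) a b ?_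
    have htight : ∀ x ∈ polyhedron (flip K a) (flip K b) A S,
        inner ℝ (flip K a j) x = flip K b j := by
      intro x hx
      have hterm : ∀ i ∈ S, l i * (inner ℝ (a i) x - b i) ≤ 0 := by
        intro i hi
        have h1 := hx.2 i hi
        by_cases h : i ∈ K
        · have h2 := (Finset.mem_filter.1 h).2
          simp only [flip, h, if_true, inner_neg_left, neg_le_neg_iff] at h1
          nlinarith
        · have h2 : 0 ≤ l i := by
            by_contra hlt
            exact h (Finset.mem_filter.2 ⟨hi, not_le.1 hlt⟩)
          simp only [flip, h, if_false] at h1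
          nlinarith
      have h0 := (Finset.sum_eq_zero_iff_of_nonpos hterm).1
        (le_antisymm (Finset.sum_nonpos hterm) (hl x hx.1)) j hj
      have h1 : inner ℝ (a j) x = b j := sub_eq_zero.1 ((mul_eq_zero.1 h0).resolve_left hlj)
      by_cases h : j ∈ K <;> simp [flip, h, h1]
    have hS := Finset.insert_erase hj
    have h1 := totalDefect_of_subset_hyperplane z (flip K a) (flip K b) A
      (Finset.notMem_erase j S) (by rwa [hS])
    rw [hS] at h1
    rw [h1]
    exact ih _ (Finset.erase_ssubset hj) (flip K a) (flip K b)
      (A ⊓ hyperplane (flip K a j) (flip K b j))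

/-! ### From cells to faces and normal cones -/

theorem radialClosure_cell (a : ι → V) (b : ι → ℝ) (A : AffineSubspace ℝ V)
    {S I : Finset ι} (hne : (cell a b A S I).Nonempty) :
    radialClosure (cell a b A S I) =
      {y | y ∈ polyhedron a b A S ∧ ∀ i ∈ I, inner ℝ (a i) y = b i} :=
  Set.Subset.antisymm (radialClosure_cell_subset a b A hne)
    fun _ hy => mem_radialClosure_cell a b A.convex hy.1 hy.2

theorem vectorSpan_radialClosure {U : Set V} (hU : RelOpen U) (hne : U.Nonempty) :
    vectorSpan ℝ (radialClosure U) = vectorSpan ℝ U := by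
  refine le_antisymm ?_ (vectorSpan_mono ℝ (subset_radialClosure hU.1))
  obtain ⟨p, hp⟩ := hne
  rw [vectorSpan_eq_span_vsub_set_right ℝ (subset_radialClosure hU.1 hp), Submodule.span_le]
  rintro _ ⟨y, hy, rfl⟩
  have h := vsub_mem_vectorSpan ℝ (hy p hp (1 / 2) (by norm_num) (by norm_num)) hp
  have e : y + (1 / 2 : ℝ) • (p - y) -ᵥ p = (1 / 2 : ℝ) • (y - p) := by
    rw [vsub_eq_sub]
    match_scalars <;> norm_num
  rw [e] at h
  exact (Submodule.smul_mem_iff _ (by norm_num : (1 / 2 : ℝ) ≠ 0)).1 h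

variable {d : ℕ}

theorem critical_iff_mem_sub_normalCone {z : EuclideanSpace ℝ (Fin d)}
    {Q U : Set (EuclideanSpace ℝ (Fin d))} (hU : RelOpen U) (hUQ : U ⊆ Q) (hne : U.Nonempty) :
    Critical z Q U ↔ z ∈ radialClosure U - normalCone (radialClosure U) Q := by
  rw [Set.mem_sub]
  constructor
  · rintro ⟨y, hy, hN⟩
    exact ⟨y, hy, y - z, fun x hx w hw => hN.inner_le hUQ hne hx hw, sub_sub_cancel y z⟩
  · rintro ⟨y, hy, c, hc, rfl⟩
    refine ⟨y, hy, fun x hx u hu => ?_⟩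
    rw [sub_sub_cancel]
    exact hc x hx u (subset_radialClosure hU.1 hu)

variable {n : ℕ} (a : Fin n → EuclideanSpace ℝ (Fin d)) (b : Fin n → ℝ)

/-- The open face of `{x | ∀ i, ⟨a i, x⟩ ≤ b i}` on which exactly the constraints in `I` are
tight. -/
abbrev openFace (I : Finset (Fin n)) : Set (EuclideanSpace ℝ (Fin d)) :=
  cell a b (⊤ : AffineSubspace ℝ (EuclideanSpace ℝ (Fin d))) Finset.univ I

theorem polyhedron_top_univ :
    polyhedron a b (⊤ : AffineSubspace ℝ (EuclideanSpace ℝ (Fin d))) Finset.univ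
      = {x | ∀ i, inner ℝ (a i) x ≤ b i} := by
  ext x; simp [polyhedron]

theorem relOpen_openFace (I : Finset (Fin n)) : RelOpen (openFace a b I) :=
  relOpen_cell a b (relOpen_affineSubspace _) _ _

theorem radialClosure_openFace {I : Finset (Fin n)} (hne : (openFace a b I).Nonempty) :
    radialClosure (openFace a b I)
      = {y | (∀ i, inner ℝ (a i) y ≤ b i) ∧ ∀ i ∈ I, inner ℝ (a i) y = b i} := by
  rw [radialClosure_cell a b _ hne, polyhedron_top_univ]
  rfl

theorem subset_of_radialClosure_openFace_eq {I J : Finset (Fin n)}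
    (hI : (openFace a b I).Nonempty) (hJ : (openFace a b J).Nonempty)
    (h : radialClosure (openFace a b I) = radialClosure (openFace a b J)) : J ⊆ I := by
  obtain ⟨x, hx⟩ := id hI
  have hxJ := subset_radialClosure (relOpen_openFace a b I).1 hx
  rw [h, radialClosure_openFace a b hJ] at hxJ
  intro i hi
  by_contra hiI
  exact (hx.2.2 i (Finset.mem_univ i) hiI).ne (hxJ.2 i hi)

/-- The sum of the normals in `I` exposes the face: over the polyhedron it is at most the sum of the
`b i`, with equality exactly when all constraints in `I` are tight. -/
theorem radialClosure_openFace_mem_faces {I : Finset (Fin n)} (hne : (openFace a b I).Nonempty) :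
    radialClosure (openFace a b I) ∈ faces {x | ∀ i, inner ℝ (a i) x ≤ b i} := by
  refine ⟨hne.mono (subset_radialClosure (relOpen_openFace a b I).1), fun _ => ?_⟩
  refine ⟨innerSL ℝ (∑ i ∈ I, a i), ?_⟩
  obtain ⟨p, hp⟩ := id hne
  have hpQ : ∀ i, inner ℝ (a i) p ≤ b i := fun i =>
    (cell_subset_polyhedron a b _ _ _ hp).2 i (Finset.mem_univ i)
  rw [radialClosure_openFace a b hne]
  simp only [innerSL_apply_apply, sum_inner]
  ext x
  refine and_congr_right fun hx => ⟨fun h y hy => ?_, fun h => ?_⟩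
  · exact Finset.sum_le_sum fun i hi => (hy i).trans_eq (h i hi).symm
  · have h1 := h p hpQ
    rw [Finset.sum_congr rfl hp.2.1] at h1
    exact (Finset.sum_eq_sum_iff_of_le fun i _ => hx i).1
      (le_antisymm (Finset.sum_le_sum fun i _ => hx i) h1)

/-- Take a point of `F` with the fewest tight constraints. A constraint is tight at a midpoint only
if tight at both ends, so by minimality its tight set is contained in that of every point of `F`. -/
theorem exists_openFace_of_mem_faces {F : Set (EuclideanSpace ℝ (Fin d))}
    (hF : F ∈ faces {x | ∀ i, inner ℝ (a i) x ≤ b i}) :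
    ∃ I, (openFace a b I).Nonempty ∧ radialClosure (openFace a b I) = F := by
  classical
  obtain ⟨hne, hexp⟩ := hF
  obtain ⟨l, hl⟩ := hexp hne
  have hconv : Convex ℝ F := by
    have hQ : Convex ℝ {x | ∀ i, inner ℝ (a i) x ≤ b i} := by
      rw [← polyhedron_top_univ]
      exact convex_polyhedron a b (AffineSubspace.convex _) _
    exact hexp.convex hQ
  let act : EuclideanSpace ℝ (Fin d) → Finset (Fin n) :=
    fun x => Finset.univ.filter fun i => inner ℝ (a i) x = b i
  have hFQ : ∀ x ∈ F, ∀ i, inner ℝ (a i) x ≤ b i := fun x hx => by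
    rw [hl] at hx; exact hx.1
  obtain ⟨p, hp, hmin⟩ : ∃ p ∈ F, ∀ x ∈ F, act p ⊆ act x := by
    obtain ⟨p, hp, hmin⟩ := exists_minimalFor_of_wellFoundedLT (· ∈ F) (fun x => (act x).card) hne
    refine ⟨p, hp, fun x hx i hi => ?_⟩
    have hm := convex_step hconv hp hx (t := 1 / 2) (by norm_num) (by norm_num)
    have hval : ∀ j, inner ℝ (a j) (p + (1 / 2 : ℝ) • (x - p))
        = 1 / 2 * inner ℝ (a j) p + 1 / 2 * inner ℝ (a j) x := fun j => by
      rw [inner_add_smul_sub]; ring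
    have htight : ∀ j ∈ act (p + (1 / 2 : ℝ) • (x - p)), j ∈ act p ∧ j ∈ act x := by
      intro j hj
      have h1 := (Finset.mem_filter.1 hj).2
      rw [hval] at h1
      have h2 := hFQ p hp j
      have h3 := hFQ x hx j
      exact ⟨Finset.mem_filter.2 ⟨Finset.mem_univ j, by linarith⟩,
        Finset.mem_filter.2 ⟨Finset.mem_univ j, by linarith⟩⟩
    have hsub : act (p + (1 / 2 : ℝ) • (x - p)) ⊆ act p := fun j hj => (htight j hj).1
    have heq := Finset.eq_of_subset_of_card_le hsub
      (by
        rcases le_total (act p).card (act (p + (1 / 2 : ℝ) • (x - p))).card with h | h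
        · exact h
        · exact hmin hm h)
    exact (htight i (heq ▸ hi)).2
  have hpU : p ∈ openFace a b (act p) := by
    refine ⟨trivial, fun i hi => (Finset.mem_filter.1 hi).2, fun i _ hi => ?_⟩
    exact lt_of_le_of_ne (hFQ p hp i) fun h => hi (Finset.mem_filter.2 ⟨Finset.mem_univ i, h⟩)
  refine ⟨act p, ⟨p, hpU⟩, Set.Subset.antisymm (fun y hy => ?_) fun x hx => ?_⟩
  · -- `y` and `p` lie on a segment of `Q` that extends beyond the maximizer `p`
    have hmid := hy p hpU (1 / 2) (by norm_num) (by norm_num)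
    obtain ⟨t, ht, htU⟩ := (relOpen_openFace a b (act p)).2 p hpU _ hmid
    have hQ := fun i => (cell_subset_polyhedron a b _ _ _ htU).2 i (Finset.mem_univ i)
    rw [radialClosure_openFace a b ⟨p, hpU⟩] at hy
    rw [hl] at hp ⊢
    have h1 := hp.2 _ hQ
    simp only [map_add, map_smul, map_sub, smul_eq_mul] at h1
    refine ⟨hy.1, fun w hw => (hp.2 w hw).trans ?_⟩
    nlinarith
  · rw [radialClosure_openFace a b ⟨p, hpU⟩]
    exact ⟨hFQ x hx, fun i hi => (Finset.mem_filter.1 (hmin x hx hi)).2⟩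

/-- Sums over the faces of a polyhedron are sums over the nonempty open faces. -/
theorem finsum_faces {M : Type*} [AddCommMonoid M] (f : Set (EuclideanSpace ℝ (Fin d)) → M) :
    ∑ᶠ F ∈ faces {x | ∀ i, inner ℝ (a i) x ≤ b i}, f F
      = ∑ᶠ I ∈ {I | (openFace a b I).Nonempty}, f (radialClosure (openFace a b I)) := by
  refine (finsum_mem_eq_of_bijOn (fun I => radialClosure (openFace a b I)) ⟨?_, ?_, ?_⟩
    fun _ _ => rfl).symm
  · exact fun I hI => radialClosure_openFace_mem_faces a b hI
  · exact fun I hI J hJ h => Finset.Subset.antisymm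
      (subset_of_radialClosure_openFace_eq a b hJ hI h.symm)
      (subset_of_radialClosure_openFace_eq a b hI hJ h)
  · exact fun F hF => exists_openFace_of_mem_faces a b hF

theorem finsum_nonempty_eq_sum (f : Finset (Fin n) → ℤ) (g : Finset (Fin n) → ℤ)
    (h : ∀ I, (openFace a b I).Nonempty → f I = g I)
    (h0 : ∀ I, openFace a b I = ∅ → g I = 0) :
    ∑ᶠ I ∈ {I | (openFace a b I).Nonempty}, f I = ∑ I, g I := by
  rw [finsum_mem_congr (s := {I | (openFace a b I).Nonempty}) rfl h,
    finsum_mem_eq_sum_of_inter_support_eq g (t := Finset.univ)]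
  ext I
  simp only [Set.mem_inter_iff, Set.mem_ofPred_eq, Function.mem_support, Finset.coe_univ,
    Set.mem_univ, true_and, and_iff_right_iff_imp]
  exact fun hg => Set.nonempty_iff_ne_empty.2 fun he => hg (h0 I he)

end Polyhedra

theorem theorem3p10 (d : ℕ) (Q : Set (EuclideanSpace ℝ (Fin d)))
    (hQ : Polyhedra.IsPolyhedron Q) :
    Polyhedra.eulerChar Q • Polyhedra.ind (Set.univ : Set (EuclideanSpace ℝ (Fin d)))
      = ∑ᶠ F ∈ Polyhedra.faces Q,
          (-1 : ℤ) ^ Polyhedra.dim F • Polyhedra.ind (F - Polyhedra.normalCone F Q) := by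
  open Polyhedra in
  have hfin := hQ.finite_faces
  obtain ⟨n, a, b, rfl⟩ := hQ
  have hdim : ∀ I, (openFace a b I).Nonempty →
      (-1 : ℤ) ^ dim (radialClosure (openFace a b I)) = sign (openFace a b I) := by
    intro I hI
    rw [dim, vectorSpan_radialClosure (relOpen_openFace a b I) hI, sign, if_pos hI]
  funext z
  -- Finiteness of the set of faces is what lets evaluation at `z` pass through the finite-support
  -- sum.
  have heval := (Pi.evalAddMonoidHom (fun _ : EuclideanSpace ℝ (Fin d) => ℤ) z).map_finsum_mem
    (fun F => (-1 : ℤ) ^ dim F • ind (F - normalCone F {x | ∀ i, inner ℝ (a i) x ≤ b i})) hfin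
  simp only [Pi.evalAddMonoidHom_apply, Pi.smul_apply, smul_eq_mul] at heval
  rw [heval, finsum_faces a b, Pi.smul_apply, eulerChar, finsum_faces a b,
    finsum_nonempty_eq_sum a b _ (fun I => sign (openFace a b I)) hdim
      fun I hI => by rw [hI, sign_empty],
    finsum_nonempty_eq_sum a b _ (fun I => weight z {x | ∀ i, inner ℝ (a i) x ≤ b i}
      (openFace a b I)) (fun I hI => ?_) fun I hI => by rw [hI, weight_empty]]
  · have h := totalDefect_eq_zero z Finset.univ a b ⊤
    rw [totalDefect, polyhedron_top_univ, Finset.powerset_univ] at h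
    simp only [defect, Finset.sum_sub_distrib] at h
    rw [sub_eq_zero.1 h]
    rw [ind, Set.indicator_univ, Pi.one_apply, smul_eq_mul, mul_one]
  · have hsub : openFace a b I ⊆ {x | ∀ i, inner ℝ (a i) x ≤ b i} := by
      rw [← polyhedron_top_univ]
      exact cell_subset_polyhedron a b _ _ _
    have hcrit := critical_iff_mem_sub_normalCone (z := z) (relOpen_openFace a b I) hsub hI
    rw [hdim I hI, weight, ind]
    by_cases hc : Critical z {x | ∀ i, inner ℝ (a i) x ≤ b i} (openFace a b I)
    · rw [if_pos hc, Set.indicator_of_mem (hcrit.1 hc), Pi.one_apply, mul_one]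
    · rw [if_neg hc, Set.indicator_of_notMem fun h => hc (hcrit.2 h), mul_zero]
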